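/- Let $\overline K$ be an algebraically closed field with a valuation $\bar v$, written additively, with value group $\Gamma=\Gamma_{\bar v}$. *Balls.* A quasi-cut in $\Gamma$ is a pair $\delta=(\delta^L,\delta^R)$ of subsets of $\Gamma$ with $\delta^L\le\delta^R$ and $\delta^L\cup\delta^R=\Gamma$; it is a cut if $\delta^L<\delta^R$, and otherwise it is the principal quasi-cut $(\Gamma_{\le\gamma},\Gamma_{\ge\gamma})$ of a unique $\gamma\in\Gamma$, with which it is identified. Put $\delta\le\epsilon$ if $\delta^L\subseteq\epsilon^L$ and $\delta^R\supseteq\epsilon^R$. For $a\in\overline K$ let $B(a,\delta)=\{c\mid \bar v(c-a)\ge\gamma\}$ if $\delta=\gamma\in\Gamma$, and $B(a,\delta)=\{c\mid\bar v(c-a)>\delta^L\}$ if $\delta$ is a cut. Let $\mathbb B_{\rm qcut}$ be the set of all pointed balls $B^\bullet(a,\delta)=(B(a,\delta),\delta)$, ordered by $B^\bullet(a,\delta)\le B^\bullet(b,\epsilon)$ iff $B(a,\delta)\supseteq B(b,\epsilon)$ and $\delta\le\epsilon$. Let $\mathbb B_\infty$ be the set of nests $\mathcal B=(B_i)_{i\in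 I}$ of closed balls with radii in $\Gamma$ ($I$ totally ordered, $i<j\Leftrightarrow B_i\supsetneq B_j$) with $\bigcap_{i\in I} B_i=\emptyset$, modulo mutual cofinality. Order $\mathbb B=\mathbb B_\infty\sqcup\mathbb B_{\rm qcut}$ by extending the order of $\mathbb B_{\rm qcut}$: the elements of $\mathbb B_\infty$ are maximal and pairwise incomparable, and $(B,\delta)\le[\mathcal B]$ iff $B\supseteq B_i$ for some $i\in I$. *Valuations.* Let $\mathbb V(\overline K)$ be the set of equivalence classes of valuations on $\overline K(x)$ whose restriction to $\overline K$ is equivalent to $\bar v$, ordered by $\mu\le\nu$ iff $\mu(f)\le\nu(f)$ for all $f\in\overline K[x]$; this means that either $\mu$ and $\nu$ are equivalent, or for every nonzero $f\in\overline K[x]$ there is $\gamma\in\Gamma$ with $\mu(f)\le\gamma\le\nu(f)$. *Valuations attached to balls.* For $a\in\overline K$ and a quasi-cut $\delta$, let $\omega_{a,\delta}$ be the monomial valuation $$\omega_{a,\delta}\Big(\sum_{n\ge0} a_n(x-a)^n\Big)=\min_{n\ge 0}\{\bar v(a_n)+n x_\delta\},$$ where $x_\delta=\delta$ if $\delta\in\Gamma$,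 and where, if $\delta$ is a cut, $x_\delta$ is the generator of the ordered group $\mathbb Z x_\delta\oplus\Gamma$ with $\delta^L<x_\delta<\delta^R$. For a nest $\mathcal B=(B_i)_{i\in I}$ of closed balls with empty intersection, let $\omega_{\mathcal B}(f)=\max\{\omega_{B_i}(f)\mid i\in I\}$ for $f\in\overline K[x]$, where $\omega_{B_i}=\omega_{a,\gamma}$ if $B_i=B(a,\gamma)$ with $\gamma\in\Gamma$. **Theorem.** The mapping $\mathbb B\to\mathbb V(\overline K)$ that sends $B^\bullet(a,\delta)$ to the class of $\omega_{a,\delta}$, and $[\mathcal B]$ to the class of $\omega_{\mathcal B}$, is well defined and is an isomorphism of posets. In particular, every valuation on $\overline K(x)$ whose restriction to $\overline K$ is equivalent to $\bar v$ is equivalent to $\omega_B$ for exactly one $B\in\mathbb B$. -/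

import Mathlib

open Polynomial

universe u

namespace ValTree

/-! ### Quasi-cuts -/

/-- A quasi-cut in a totally ordered set `Γ`: a pair `(δᴸ, δᴿ)` of subsets of `Γ` with
`δᴸ ≤ δᴿ` and `δᴸ ∪ δᴿ = Γ`. -/
@[ext]
structure QuasiCut (Γ : Type u) [LinearOrder Γ] where
  left : Set Γ
  right : Set Γ
  left_le_right : ∀ α ∈ left, ∀ β ∈ right, α ≤ β
  union_eq : left ∪ right = Set.univ

namespace QuasiCut

variable {Γ : Type u} [LinearOrder Γ]

/-- `δ ≤ ε` if and only if `δᴸ ⊆ εᴸ` and `δᴿ ⊇ εᴿ`. -/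
instance : PartialOrder (QuasiCut Γ) where
  le δ ε := δ.left ⊆ ε.left ∧ ε.right ⊆ δ.right
  le_refl _ := ⟨subset_rfl, subset_rfl⟩
  le_trans _ _ _ h₁ h₂ := ⟨h₁.1.trans h₂.1, h₂.2.trans h₁.2⟩
  le_antisymm _ _ h₁ h₂ :=
    QuasiCut.ext (h₁.1.antisymm h₂.1) (h₂.2.antisymm h₁.2)

/-- A cut is a quasi-cut with `δᴸ < δᴿ`. The other quasi-cuts are the principal ones, the pairs
`(Γ_{≤ γ}, Γ_{≥ γ})`, which are identified with the elements `γ` of `Γ`. -/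
def IsCut (δ : QuasiCut Γ) : Prop := ∀ α ∈ δ.left, ∀ β ∈ δ.right, α < β

end QuasiCut

section

variable {K Γ : Type u} [Field K] [AddCommGroup Γ] [LinearOrder Γ] [IsOrderedAddMonoid Γ]

/-! ### Pointed balls -/

/-- The ball `B(a, δ)` with centre `a` and radius a quasi-cut `δ`. If `δ` is a cut, it is
`{c | v (c - a) > δᴸ}`. If `δ` is the principal quasi-cut of `γ`, then `δᴸ = Γ_{≤ γ}` and it is
the closed ball `{c | v (c - a) ≥ γ}`. -/
def ball (v : AddValuation K (WithTop Γ)) (a : K) (δ : QuasiCut Γ) : Set K :=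
  {c | (∀ γ ∈ δ.left, (γ : WithTop Γ) ≤ v (c - a)) ∧
    (δ.IsCut → ∀ γ ∈ δ.left, (γ : WithTop Γ) < v (c - a))}

/-- The closed ball `B(a, γ)` with centre `a` and radius `γ ∈ Γ`. -/
def closedBall (v : AddValuation K (WithTop Γ)) (a : K) (γ : Γ) : Set K :=
  {c | (γ : WithTop Γ) ≤ v (c - a)}

/-- A pointed ball `(B(a, δ), δ)`: an underlying ball together with a radius, which is a
quasi-cut. -/
@[ext]
structure PointedBall (v : AddValuation K (WithTop Γ)) where
  under : Set K
  radius : QuasiCut Γ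
  exists_center : ∃ a : K, under = ball v a radius

/-- The pointed ball `(B(a, δ), δ)`. -/
def pointedBall (v : AddValuation K (WithTop Γ)) (a : K) (δ : QuasiCut Γ) : PointedBall v :=
  ⟨ball v a δ, δ, a, rfl⟩

/-- Pointed balls are ordered by reverse inclusion of the underlying balls and by the order of
the radii. -/
instance (v : AddValuation K (WithTop Γ)) : PartialOrder (PointedBall v) where
  le B C := C.under ⊆ B.under ∧ B.radius ≤ C.radius
  le_refl _ := ⟨subset_rfl, le_rfl⟩
  le_trans _ _ _ h₁ h₂ := ⟨h₂.1.trans h₁.1, h₁.2.trans h₂.2⟩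
  le_antisymm _ _ h₁ h₂ :=
    PointedBall.ext (h₂.1.antisymm h₁.1) (h₁.2.antisymm h₂.2)

/-! ### Nests of closed balls with empty intersection -/

/-- A nest of closed balls with radii in `Γ` and with empty intersection: a family of such balls,
indexed by a totally ordered set, with `i < j` if and only if `B_i ⊋ B_j`. -/
structure Nest (v : AddValuation K (WithTop Γ)) where
  Index : Type u
  [linearOrder : LinearOrder Index]
  toSet : Index → Set K
  exists_eq_closedBall : ∀ i, ∃ (a : K) (γ : Γ), toSet i = closedBall v a γ
  lt_iff_ssubset : ∀ i j, i < j ↔ toSet j ⊂ toSet i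
  iInter_eq_empty : ⋂ i, toSet i = ∅

/-- Two nests are equivalent if they are mutually cofinal. -/
instance Nest.setoid (v : AddValuation K (WithTop Γ)) : Setoid (Nest v) where
  r B C := (∀ i, ∃ j, C.toSet j ⊆ B.toSet i) ∧ (∀ j, ∃ i, B.toSet i ⊆ C.toSet j)
  iseqv :=
    { refl := fun _ => ⟨fun i => ⟨i, subset_rfl⟩, fun i => ⟨i, subset_rfl⟩⟩
      symm := fun h => ⟨h.2, h.1⟩
      trans := fun {_ _ _} h₁ h₂ =>
        ⟨fun i => by
          obtain ⟨j, hj⟩ := h₁.1 i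
          obtain ⟨k, hk⟩ := h₂.1 j
          exact ⟨k, hk.trans hj⟩,
        fun k => by
          obtain ⟨j, hj⟩ := h₂.2 k
          obtain ⟨i, hi⟩ := h₁.2 j
          exact ⟨i, hi.trans hj⟩⟩ }

/-- Nests of closed balls with empty intersection, modulo mutual cofinality. -/
def NestClass (v : AddValuation K (WithTop Γ)) : Type (u + 1) := Quotient (Nest.setoid v)

/-- A subset of `K` contains some ball of the nest; this only depends on the class of the nest. -/
def NestClass.SomeBallSubset {v : AddValuation K (WithTop Γ)} (S : Set K) (N : NestClass v) :
    Prop :=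
  Quotient.liftOn N (fun B => ∃ i, B.toSet i ⊆ S) (fun _ _ h => propext
    ⟨fun ⟨i, hi⟩ => (h.1 i).imp fun _ hj => hj.trans hi,
      fun ⟨j, hj⟩ => (h.2 j).imp fun _ hi => hi.trans hj⟩)

/-! ### The space of balls -/

/-- The disjoint union of the set of classes of nests and the set of pointed balls. -/
inductive BallSpace (v : AddValuation K (WithTop Γ)) : Type (u + 1)
  | ofNest (N : NestClass v) : BallSpace v
  | ofBall (B : PointedBall v) : BallSpace v

/-- The order of the space of balls extends the one of the pointed balls. The classes of nests are
maximal elements, and a pointed ball lies below (the class of) a nest if and only if its underlying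
ball contains some ball of the nest. -/
def BallSpace.le {v : AddValuation K (WithTop Γ)} : BallSpace v → BallSpace v → Prop
  | .ofBall B, .ofBall C => B ≤ C
  | .ofBall B, .ofNest N => N.SomeBallSubset B.under
  | .ofNest N, .ofNest M => N = M
  | .ofNest _, .ofBall _ => False

instance (v : AddValuation K (WithTop Γ)) : PartialOrder (BallSpace v) where
  le := BallSpace.le
  le_refl A := by
    cases A with
    | ofNest N => exact rfl
    | ofBall B => exact le_refl B
  le_trans A B C h₁ h₂ := by
    cases A with
    | ofNest N =>
      cases B with
      | ofNest M =>
        have h : N = M := h₁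
        subst h
        exact h₂
      | ofBall B => exact h₁.elim
    | ofBall A =>
      cases B with
      | ofNest M =>
        cases C with
        | ofNest N =>
          have h : M = N := h₂
          subst h
          exact h₁
        | ofBall C => exact h₂.elim
      | ofBall B =>
        cases C with
        | ofNest N =>
          have h₁' : A ≤ B := h₁
          induction N using Quotient.inductionOn with
          | h N =>
            obtain ⟨i, hi⟩ := h₂
            exact ⟨i, hi.trans h₁'.1⟩
        | ofBall C =>
          have h₁' : A ≤ B := h₁
          have h₂' : B ≤ C := h₂
          exact h₁'.trans h₂'
  le_antisymm A B h₁ h₂ := by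
    cases A with
    | ofNest N =>
      cases B with
      | ofNest M => exact congrArg _ h₁
      | ofBall B => exact h₁.elim
    | ofBall A =>
      cases B with
      | ofNest M => exact h₂.elim
      | ofBall B =>
        have h₁' : A ≤ B := h₁
        have h₂' : B ≤ A := h₂
        exact congrArg _ (h₁'.antisymm h₂')

/-! ### The space of equivalence classes of valuations on `K(x)` -/

/-- A valuation on `K(x)`, with values in an ordered abelian group (and `∞`), whose restriction to
`K` is equivalent to `v`. -/
structure ValExt (v : AddValuation K (WithTop Γ)) where
  Val : Type u
  [addCommGroup : AddCommGroup Val]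
  [linearOrder : LinearOrder Val]
  [isOrderedAddMonoid : IsOrderedAddMonoid Val]
  val : AddValuation (RatFunc K) (WithTop Val)
  isEquiv : (val.comap (RatFunc.C : K →+* RatFunc K)).IsEquiv v

attribute [instance] ValExt.addCommGroup ValExt.linearOrder ValExt.isOrderedAddMonoid

/-- Equivalence of valuations. -/
instance ValExt.setoid (v : AddValuation K (WithTop Γ)) : Setoid (ValExt v) where
  r μ ν := μ.val.IsEquiv ν.val
  iseqv :=
    { refl := fun _ => AddValuation.IsEquiv.refl
      symm := fun h => h.symm
      trans := fun h₁ h₂ => h₁.trans h₂ }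

/-- The set of equivalence classes of valuations on `K(x)` whose restriction to `K` is equivalent
to `v`. -/
def ValSpace (v : AddValuation K (WithTop Γ)) : Type (u + 1) := Quotient (ValExt.setoid v)

/-- For every nonzero `f ∈ K[x]` there is a value `γ = v c` in the value group of `v` such that
`μ(f) ≤ γ ≤ ν(f)`. Here `γ` is seen in the value groups of `μ` and `ν` as `μ(c)` and `ν(c)`. -/
def ValExt.Below {v : AddValuation K (WithTop Γ)} (μ ν : ValExt v) : Prop :=
  ∀ f : K[X], f ≠ 0 → ∃ c : K, c ≠ 0 ∧
    μ.val (algebraMap K[X] (RatFunc K) f) ≤ μ.val (RatFunc.C c) ∧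
    ν.val (RatFunc.C c) ≤ ν.val (algebraMap K[X] (RatFunc K) f)

theorem ValExt.Below.congr {v : AddValuation K (WithTop Γ)} {μ ν μ' ν' : ValExt v}
    (hμ : μ.val.IsEquiv μ'.val) (hν : ν.val.IsEquiv ν'.val) (h : μ.Below ν) : μ'.Below ν' := by
  intro f hf
  obtain ⟨c, hc, h₁, h₂⟩ := h f hf
  exact ⟨c, hc, (hμ _ _).1 h₁, (hν _ _).1 h₂⟩

theorem ValExt.le_iff {v : AddValuation K (WithTop Γ)} (μ ν : ValExt v) (c d : K) :
    μ.val (RatFunc.C c) ≤ μ.val (RatFunc.C d) ↔ ν.val (RatFunc.C c) ≤ ν.val (RatFunc.C d) :=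
  (μ.isEquiv d c).trans (ν.isEquiv d c).symm

theorem ValExt.Below.trans {v : AddValuation K (WithTop Γ)} {μ ν ρ : ValExt v}
    (h₁ : μ.Below ν) (h₂ : ν.Below ρ) : μ.Below ρ := by
  intro f hf
  obtain ⟨c, hc, a₁, a₂⟩ := h₁ f hf
  obtain ⟨d, hd, b₁, b₂⟩ := h₂ f hf
  exact ⟨c, hc, a₁, ((ν.le_iff ρ c d).1 (a₂.trans b₁)).trans b₂⟩

theorem ValExt.Below.isEquiv {v : AddValuation K (WithTop Γ)} {μ ν : ValExt v}
    (h₁ : μ.Below ν) (h₂ : ν.Below μ) : μ.val.IsEquiv ν.val := by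
  have key : ∀ f : K[X], ∃ c : K,
      μ.val (algebraMap K[X] (RatFunc K) f) = μ.val (RatFunc.C c) ∧
      ν.val (algebraMap K[X] (RatFunc K) f) = ν.val (RatFunc.C c) := by
    intro f
    by_cases hf : f = 0
    · exact ⟨0, by simp [hf], by simp [hf]⟩
    obtain ⟨c, _, a₁, a₂⟩ := h₁ f hf
    obtain ⟨d, _, b₁, b₂⟩ := h₂ f hf
    have hd := (μ.le_iff ν d c).1 (b₂.trans a₁)
    have hc := (μ.le_iff ν c d).2 (a₂.trans b₁)
    exact ⟨c, a₁.antisymm (hc.trans b₂), (b₁.trans hd).antisymm a₂⟩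
  have poly : ∀ f g : K[X],
      μ.val (algebraMap K[X] (RatFunc K) f) ≤ μ.val (algebraMap K[X] (RatFunc K) g) ↔
      ν.val (algebraMap K[X] (RatFunc K) f) ≤ ν.val (algebraMap K[X] (RatFunc K) g) := by
    intro f g
    obtain ⟨c, hc₁, hc₂⟩ := key f
    obtain ⟨d, hd₁, hd₂⟩ := key g
    rw [hc₁, hc₂, hd₁, hd₂]
    exact μ.le_iff ν c d
  have scale : ∀ (ρ : ValExt v) (r s t : RatFunc K), t ≠ 0 →
      (ρ.val r ≤ ρ.val s ↔ ρ.val (r * t) ≤ ρ.val (s * t)) := by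
    intro ρ r s t ht
    have h' : ρ.val t ≠ ⊤ := fun h => ht (ρ.val.top_iff.1 h)
    rw [ρ.val.map_mul, ρ.val.map_mul]
    exact (WithTop.add_le_add_iff_right h').symm
  suffices h : ∀ r s : RatFunc K, μ.val r ≤ μ.val s ↔ ν.val r ≤ ν.val s from fun r s => h s r
  intro r s
  have hr := RatFunc.num_div_denom r
  have hs := RatFunc.num_div_denom s
  have dr : algebraMap K[X] (RatFunc K) r.denom ≠ 0 :=
    RatFunc.algebraMap_ne_zero (RatFunc.denom_ne_zero r)
  have ds : algebraMap K[X] (RatFunc K) s.denom ≠ 0 :=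
    RatFunc.algebraMap_ne_zero (RatFunc.denom_ne_zero s)
  have er : r * (algebraMap K[X] (RatFunc K) r.denom * algebraMap K[X] (RatFunc K) s.denom) =
      algebraMap K[X] (RatFunc K) (r.num * s.denom) := by
    rw [map_mul]
    nth_rewrite 1 [← hr]
    field_simp
  have es : s * (algebraMap K[X] (RatFunc K) r.denom * algebraMap K[X] (RatFunc K) s.denom) =
      algebraMap K[X] (RatFunc K) (s.num * r.denom) := by
    rw [map_mul]
    nth_rewrite 1 [← hs]
    field_simp
  rw [scale μ r s _ (mul_ne_zero dr ds), scale ν r s _ (mul_ne_zero dr ds), er, es]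
  exact poly _ _

/-- The order of the space of valuations: `[μ] ≤ [ν]` if and only if `μ(f) ≤ ν(f)` for all
`f ∈ K[x]`. When `μ` and `ν` are not equivalent this means that for every `f ≠ 0` some `γ` in the
value group of `v` satisfies `μ(f) ≤ γ ≤ ν(f)`. -/
instance (v : AddValuation K (WithTop Γ)) : PartialOrder (ValSpace v) where
  le p q := p = q ∨ Quotient.liftOn₂ p q ValExt.Below (fun _ _ _ _ h₁ h₂ => propext
    ⟨ValExt.Below.congr h₁ h₂, ValExt.Below.congr (Setoid.symm h₁) (Setoid.symm h₂)⟩)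
  le_refl _ := Or.inl rfl
  le_trans p q r h₁ h₂ := by
    rcases h₁ with rfl | h₁
    · exact h₂
    rcases h₂ with rfl | h₂
    · exact Or.inr h₁
    induction p using Quotient.inductionOn with | h μ =>
    induction q using Quotient.inductionOn with | h ν =>
    induction r using Quotient.inductionOn with | h ρ =>
    exact Or.inr (ValExt.Below.trans (ν := ν) h₁ h₂)
  le_antisymm p q h₁ h₂ := by
    rcases h₁ with rfl | h₁
    · rfl
    rcases h₂ with rfl | h₂
    · rfl
    induction p using Quotient.inductionOn with | h μ =>
    induction q using Quotient.inductionOn with | h ν =>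
    exact Quotient.sound (ValExt.Below.isEquiv h₁ h₂)

/-! ### The valuations attached to balls and nests -/

/-- `ξ`, in an ordered abelian group that contains `Γ` through `ι`, realizes the quasi-cut `δ`:
`δᴸ < ξ < δᴿ` if `δ` is a cut, and `ξ = γ` if `δ` is the principal quasi-cut of `γ`. -/
def Realizes {Λ : Type u} [LinearOrder Λ] (ι : Γ → Λ) (δ : QuasiCut Γ) (ξ : Λ) : Prop :=
  (∀ γ ∈ δ.left, ι γ ≤ ξ) ∧ (∀ γ ∈ δ.right, ξ ≤ ι γ) ∧
    (δ.IsCut → (∀ γ ∈ δ.left, ι γ < ξ) ∧ (∀ γ ∈ δ.right, ξ < ι γ))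

/-- `p` is the class of the monomial valuation `ω_{a,δ}`: it is represented by an extension of `v`
with values in an ordered abelian group containing `Γ`, given by
`∑ a_n (x - a) ^ n ↦ min {v a_n + n ξ}`, where `ξ` realizes `δ`. (The subgroup generated by `Γ` and
`ξ` is then the group `Γ` itself if `δ` is principal, and `ℤ ξ ⊕ Γ` with its unique order such that
`δᴸ < ξ < δᴿ` if `δ` is a cut.) The coefficients `a_n` of the `(x - a)`-expansion of `f` are those
of `f(x + a) = taylor a f`. -/
def ValSpace.IsMonomial {v : AddValuation K (WithTop Γ)} (p : ValSpace v) (a : K)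
    (δ : QuasiCut Γ) : Prop :=
  ∃ μ : ValExt v, Quotient.mk (ValExt.setoid v) μ = p ∧
    ∃ ι : Γ →+ μ.Val, StrictMono ι ∧ (∀ c : K, μ.val (RatFunc.C c) = (v c).map ι) ∧
      ∃ ξ : μ.Val, Realizes ι δ ξ ∧
        ∀ f : K[X], IsLeast
          (Set.range fun n : ℕ => (v ((taylor a f).coeff n)).map ι + ((n • ξ : μ.Val) : WithTop μ.Val))
          (μ.val (algebraMap K[X] (RatFunc K) f))

/-- For `γ ∈ Γ`, the value `min {v a_n + n γ}` of the monomial valuation `ω_{a,γ}` on the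
polynomial `f = ∑ a_n (x - a) ^ n`. -/
noncomputable def monomialValue (v : AddValuation K (WithTop Γ)) (a : K) (γ : Γ) (f : K[X]) : WithTop Γ :=
  (Finset.range (f.natDegree + 1)).inf fun n =>
    v ((taylor a f).coeff n) + ((n • γ : Γ) : WithTop Γ)

/-- `p` is the class of the stable limit `ω_𝓑` of the monomial valuations of the balls of the
nest `𝓑`: it is represented by a `Γ`-valued extension of `v` with
`ω_𝓑(f) = max {ω_{B_i}(f) | i}` for all `f ∈ K[x]`. -/
def ValSpace.IsStableLimit {v : AddValuation K (WithTop Γ)} (p : ValSpace v) (B : Nest v) : Prop :=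
  ∃ (w : AddValuation (RatFunc K) (WithTop Γ)) (hw : ∀ c : K, w (RatFunc.C c) = v c),
    Quotient.mk (ValExt.setoid v)
      { Val := Γ, val := w, isEquiv := AddValuation.IsEquiv.of_eq (AddValuation.ext hw) } = p ∧
    ∀ f : K[X], IsGreatest
      {y | ∃ (i : B.Index) (a : K) (γ : Γ), B.toSet i = closedBall v a γ ∧ y = monomialValue v a γ f}
      (w (algebraMap K[X] (RatFunc K) f))

end

end ValTree

/-! Over an algebraically closed field every polynomial is a constant times a product of factors `X
- C d`. Two multiplicative functions on polynomials therefore agree once they agree on constants and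
on these factors (`polynomial_induction_linear`), and an extension `μ` of `v` is governed by the
function `d ↦ μ(x - d)`.

Surjectivity is a dichotomy (`ValExt.isMonomialAt_or_isStableLimitAt`). If some `a` satisfies `μ(x -
d) = min (v (d - a)) (μ(x - a))` for all `d`, then `μ` is monomial at `a`, and its radius is the
quasi-cut that `μ(x - a)` makes in `Γ`. Otherwise every `μ(x - a)` lies in `Γ` and is exceeded by
some `μ(x - d)`; the sets `{c | γ ≤ μ(x - c)}` are then nested closed balls without a common point,
and `μ` is their stable limit.

For the order, `μ ≤ ν` preserves lower bounds in `Γ` from `μ(f)` to `ν(f)`, and upper bounds in the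
other direction; applied to `f = x - a` this yields the inclusions of balls. Conversely, for pointed
balls `B(a, δ) ≤ B(b, ε)` the point `b` is a centre of both. If `δ < ε`, some `γ` lies in both `δᴿ`
and `εᴸ`, and `ω_{b,γ}` separates the two valuations. If `δ = ε`, the valuations are equivalent: `Γ`
is divisible, so the quasi-cut alone decides every comparison of `α + nξ` with `β + mξ`
(`add_nsmul_le_iff`).

These comparisons hold for arbitrary representatives, so `BallSpace.Represents.toSpace_le_iff` gives
well-definedness and the order embedding at once. -/

namespace ValTree

/-! ### Monomial valuations on polynomials. -/

section Gauss

variable {K Λ : Type u} [Field K] [AddCommGroup Λ] [LinearOrder Λ] [IsOrderedAddMonoid Λ]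

theorem le_monomialValue_iff (w : AddValuation K (WithTop Λ)) (a : K) (ξ : Λ) (f : K[X])
    (y : WithTop Λ) :
    y ≤ monomialValue w a ξ f ↔
      ∀ n : ℕ, y ≤ w ((taylor a f).coeff n) + ((n • ξ : Λ) : WithTop Λ) := by
  rw [monomialValue, Finset.le_inf_iff]
  refine ⟨fun h n => ?_, fun h n _ => h n⟩
  by_cases hn : n ≤ f.natDegree
  · exact h n (by simpa [Nat.lt_succ_iff] using hn)
  · rw [coeff_eq_zero_of_natDegree_lt (by rw [natDegree_taylor]; omega), w.map_zero, top_add]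
    exact le_top

theorem monomialValue_le (w : AddValuation K (WithTop Λ)) (a : K) (ξ : Λ) (f : K[X]) (n : ℕ) :
    monomialValue w a ξ f ≤ w ((taylor a f).coeff n) + ((n • ξ : Λ) : WithTop Λ) :=
  (le_monomialValue_iff w a ξ f _).1 le_rfl n

theorem exists_monomialValue_eq (w : AddValuation K (WithTop Λ)) (a : K) (ξ : Λ) (f : K[X]) :
    ∃ n : ℕ, monomialValue w a ξ f = w ((taylor a f).coeff n) + ((n • ξ : Λ) : WithTop Λ) := by
  obtain ⟨n, _, hn⟩ := Finset.exists_mem_eq_inf (Finset.range (f.natDegree + 1))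
    Finset.nonempty_range_add_one
    (fun n => w ((taylor a f).coeff n) + ((n • ξ : Λ) : WithTop Λ))
  exact ⟨n, hn⟩

theorem isLeast_monomialValue (w : AddValuation K (WithTop Λ)) (a : K) (ξ : Λ) (f : K[X]) :
    IsLeast (Set.range fun n : ℕ => w ((taylor a f).coeff n) + ((n • ξ : Λ) : WithTop Λ))
      (monomialValue w a ξ f) := by
  obtain ⟨n, hn⟩ := exists_monomialValue_eq w a ξ f
  exact ⟨⟨n, hn.symm⟩, by rintro _ ⟨m, rfl⟩; exact monomialValue_le w a ξ f m⟩

theorem monomialValue_mono (w : AddValuation K (WithTop Λ)) (a : K) {ξ η : Λ} (h : ξ ≤ η)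
    (f : K[X]) : monomialValue w a ξ f ≤ monomialValue w a η f := by
  rw [le_monomialValue_iff]
  intro n
  refine (monomialValue_le w a ξ f n).trans (add_le_add le_rfl ?_)
  exact WithTop.coe_le_coe.2 (nsmul_le_nsmul_right h n)

theorem monomialValue_C (w : AddValuation K (WithTop Λ)) (a : K) (ξ : Λ) (c : K) :
    monomialValue w a ξ (C c) = w c := by
  simp [monomialValue]

theorem monomialValue_zero (w : AddValuation K (WithTop Λ)) (a : K) (ξ : Λ) :
    monomialValue w a ξ 0 = ⊤ := by
  rw [← C_0, monomialValue_C, w.map_zero]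

theorem monomialValue_eq_top_iff (w : AddValuation K (WithTop Λ)) (a : K) (ξ : Λ) (f : K[X]) :
    monomialValue w a ξ f = ⊤ ↔ f = 0 := by
  refine ⟨fun h => ?_, fun h => by rw [h, monomialValue_zero]⟩
  have h' := top_le_iff.1 (h ▸ monomialValue_le w a ξ f f.natDegree)
  rw [WithTop.add_eq_top, coeff_taylor_natDegree, w.top_iff] at h'
  simpa using h'.resolve_right WithTop.coe_ne_top

theorem min_le_monomialValue_add (w : AddValuation K (WithTop Λ)) (a : K) (ξ : Λ) (f g : K[X]) :
    min (monomialValue w a ξ f) (monomialValue w a ξ g) ≤ monomialValue w a ξ (f + g) := by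
  rw [le_monomialValue_iff]
  intro n
  rw [map_add, coeff_add]
  calc _ ≤ min (w ((taylor a f).coeff n)) (w ((taylor a g).coeff n)) +
        ((n • ξ : Λ) : WithTop Λ) := by
        rw [← min_add_add_right]
        exact min_le_min (monomialValue_le w a ξ f n) (monomialValue_le w a ξ g n)
    _ ≤ _ := add_le_add (w.map_add _ _) le_rfl

/-- Gauss's lemma. Take the least indices `i`, `j` at which the minima for `f` and `g` are attained.
Any other pair with sum `i + j` has first index below `i` or second below `j`, so the term `(i, j)`
strictly dominates that coefficient of the product. -/
theorem monomialValue_mul (w : AddValuation K (WithTop Λ)) (a : K) (ξ : Λ) (f g : K[X]) :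
    monomialValue w a ξ (f * g) = monomialValue w a ξ f + monomialValue w a ξ g := by
  classical
  by_cases hf : f = 0
  · simp [hf, monomialValue_zero]
  by_cases hg : g = 0
  · simp [hg, monomialValue_zero]
  have term : ∀ i j : ℕ, w ((taylor a f).coeff i * (taylor a g).coeff j) +
      (((i + j) • ξ : Λ) : WithTop Λ) =
      (w ((taylor a f).coeff i) + ((i • ξ : Λ) : WithTop Λ)) +
      (w ((taylor a g).coeff j) + ((j • ξ : Λ) : WithTop Λ)) := by
    intro i j
    rw [w.map_mul, add_smul, WithTop.coe_add, add_add_add_comm]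
  have hF := mt (monomialValue_eq_top_iff w a ξ f).1 hf
  have hG := mt (monomialValue_eq_top_iff w a ξ g).1 hg
  apply le_antisymm
  · have ef := exists_monomialValue_eq w a ξ f
    have eg := exists_monomialValue_eq w a ξ g
    set i := Nat.find ef with hi
    set j := Nat.find eg with hj
    have vi := Nat.find_spec ef
    have vj := Nat.find_spec eg
    have li : ∀ k < i, monomialValue w a ξ f <
        w ((taylor a f).coeff k) + ((k • ξ : Λ) : WithTop Λ) := fun k hk =>
      lt_of_le_of_ne (monomialValue_le w a ξ f k) (Nat.find_min ef hk)
    have lj : ∀ k < j, monomialValue w a ξ g <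
        w ((taylor a g).coeff k) + ((k • ξ : Λ) : WithTop Λ) := fun k hk =>
      lt_of_le_of_ne (monomialValue_le w a ξ g k) (Nat.find_min eg hk)
    have main : w ((taylor a f).coeff i * (taylor a g).coeff j) +
      (((i + j) • ξ : Λ) : WithTop Λ) = monomialValue w a ξ f + monomialValue w a ξ g := by
      rw [term, ← vi, ← vj]
    refine (monomialValue_le w a ξ (f * g) (i + j)).trans ?_
    rw [← main]
    refine add_le_add (le_of_eq ?_) le_rfl
    rw [taylor_mul, coeff_mul, ← Finset.add_sum_erase _ _
      (Finset.HasAntidiagonal.mem_antidiagonal.2 rfl : (i, j) ∈ Finset.HasAntidiagonal.antidiagonal (i + j))]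
    apply w.map_add_eq_of_lt_left
    have htop : w ((taylor a f).coeff i * (taylor a g).coeff j) ≠ ⊤ := by
      intro h
      rw [h, top_add] at main
      exact WithTop.add_ne_top.2 ⟨hF, hG⟩ main.symm
    refine w.map_lt_sum htop ?_
    rintro ⟨k, l⟩ hkl
    rw [Finset.mem_erase, Finset.HasAntidiagonal.mem_antidiagonal] at hkl
    obtain ⟨hne, hsum⟩ := hkl
    simp only at hsum
    refine lt_of_add_lt_add_right (a := (((i + j) • ξ : Λ) : WithTop Λ)) ?_
    rw [main, ← hsum, term]
    rcases lt_trichotomy k i with h | h | h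
    · exact WithTop.add_lt_add_of_lt_of_le hG (li k h) (monomialValue_le w a ξ g l)
    · exact absurd (Prod.ext h (by simp only; omega)) hne
    · exact WithTop.add_lt_add_of_le_of_lt hF (monomialValue_le w a ξ f k) (lj l (by omega))
  · rw [le_monomialValue_iff]
    intro n
    rw [taylor_mul, coeff_mul]
    -- Moving `n • ξ` to the other side leaves a lower bound for `w` of a sum, to which the
    -- ultrametric inequality applies.
    have hcancel : ∀ x : WithTop Λ, x + ((-(n • ξ) : Λ) : WithTop Λ) + ((n • ξ : Λ) : WithTop Λ) = x := by
      intro x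
      rw [add_assoc, ← WithTop.coe_add, neg_add_cancel, WithTop.coe_zero, add_zero]
    rw [← hcancel (monomialValue w a ξ f + monomialValue w a ξ g)]
    refine add_le_add (w.map_le_sum ?_) le_rfl
    rintro ⟨k, l⟩ hkl
    have hsum := Finset.HasAntidiagonal.mem_antidiagonal.1 hkl
    simp only at hsum
    refine (WithTop.add_le_add_iff_right (z := ((n • ξ : Λ) : WithTop Λ)) WithTop.coe_ne_top).1 ?_
    rw [hcancel, ← hsum, term]
    exact add_le_add (monomialValue_le w a ξ f k) (monomialValue_le w a ξ g l)

/-- The monomial valuation `∑ a_n (x - a) ^ n ↦ min {w a_n + n ξ}` on `K[x]`. -/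
noncomputable def monomialVal (w : AddValuation K (WithTop Λ)) (a : K) (ξ : Λ) :
    AddValuation K[X] (WithTop Λ) :=
  AddValuation.of (monomialValue w a ξ) (monomialValue_zero w a ξ)
    (by rw [← C_1, monomialValue_C, w.map_one])
    (min_le_monomialValue_add w a ξ) (monomialValue_mul w a ξ)

theorem monomialValue_X_sub_C (w : AddValuation K (WithTop Λ)) (a : K) (ξ : Λ) (d : K) :
    monomialValue w a ξ (X - C d) = min (w (d - a)) (ξ : WithTop Λ) := by
  rw [monomialValue, natDegree_X_sub_C, Finset.range_add_one, Finset.range_one]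
  simp only [Finset.inf_insert, Finset.inf_singleton, map_sub, taylor_X, taylor_C]
  rw [min_comm, w.map_sub_swap d a]
  simp [coeff_X, coeff_C]

end Gauss

/-! ### Extension to rational functions, and reduction to linear factors. -/

section Extend

variable {K Λ : Type u} [Field K] [AddCommGroup Λ] [LinearOrder Λ] [IsOrderedAddMonoid Λ]

theorem exists_extend_ratFunc (w : AddValuation K[X] (WithTop Λ))
    (hw : ∀ f : K[X], w f = ⊤ → f = 0) :
    ∃ W : AddValuation (RatFunc K) (WithTop Λ), ∀ f : K[X], W (algebraMap K[X] (RatFunc K) f) = w f := by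
  have hS : nonZeroDivisors K[X] ≤ (AddValuation.toValuation w).supp.primeCompl := by
    intro f hf h
    exact nonZeroDivisors.ne_zero hf (hw f ((AddValuation.mem_supp_iff w f).1 h))
  exact ⟨AddValuation.ofValuation
    ((AddValuation.toValuation w).extendToLocalization hS (RatFunc K)), fun f =>
    Valuation.extendToLocalization_apply_map_apply _ hS (RatFunc K) f⟩

theorem polynomial_induction_linear [IsAlgClosed K] {P : K[X] → Prop}
    (hC : ∀ c, P (C c)) (hX : ∀ d, P (X - C d)) (hmul : ∀ f g, P f → P g → P (f * g))
    (f : K[X]) : P f := by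
  rw [(IsAlgClosed.splits f).eq_prod_roots]
  refine hmul _ _ (hC _) ?_
  induction f.roots using Multiset.induction_on with
  | empty => simpa using hC 1
  | cons d s ih =>
    rw [Multiset.map_cons, Multiset.prod_cons]
    exact hmul _ _ (hX d) ih

end Extend

/-! ### Quasi-cuts and the elements realizing them. -/

section QuasiCut

variable {Γ Λ : Type u} [LinearOrder Γ] [LinearOrder Λ]

theorem QuasiCut.mem_right_iff (δ : QuasiCut Γ) (τ : Γ) :
    τ ∈ δ.right ↔ (∀ γ ∈ δ.left, γ ≤ τ) ∧ (δ.IsCut → ∀ γ ∈ δ.left, γ < τ) := by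
  refine ⟨fun h => ⟨fun γ hγ => δ.left_le_right γ hγ τ h, fun hc γ hγ => hc γ hγ τ h⟩, ?_⟩
  rintro ⟨h₁, h₂⟩
  rcases (δ.union_eq ▸ Set.mem_univ τ : τ ∈ δ.left ∪ δ.right) with h | h
  · by_cases hc : δ.IsCut
    · exact absurd (h₂ hc τ h) (lt_irrefl _)
    -- The two halves share a point, which is the maximum of the left half; `τ` is also a maximum of
    -- the left half, hence equals it.
    · simp only [QuasiCut.IsCut, not_forall, not_lt] at hc
      obtain ⟨α, hα, β, hβ, hle⟩ := hc
      obtain rfl := le_antisymm (δ.left_le_right α hα β hβ) hle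
      obtain rfl := le_antisymm (h₁ α hα) (δ.left_le_right τ h α hβ)
      exact hβ
  · exact h

theorem QuasiCut.mem_left_iff_of_realizes {ι : Γ → Λ} (hι : StrictMono ι) {δ : QuasiCut Γ} {ξ : Λ}
    (h : Realizes ι δ ξ) (γ : Γ) : γ ∈ δ.left ↔ ι γ ≤ ξ := by
  refine ⟨h.1 γ, fun hγ => ?_⟩
  rcases (δ.union_eq ▸ Set.mem_univ γ : γ ∈ δ.left ∪ δ.right) with hl | hr
  · exact hl
  · by_contra hl
    have hc : ¬ δ.IsCut := fun hc => absurd ((h.2.2 hc).2 γ hr) (not_lt.2 hγ)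
    simp only [QuasiCut.IsCut, not_forall, not_lt] at hc
    obtain ⟨α, hα, β, hβ, hle⟩ := hc
    have := h.2.1 β hβ
    have := hι.le_iff_le.1 (hγ.trans this)
    obtain rfl := le_antisymm (this.trans hle) (δ.left_le_right α hα γ hr)
    exact hl hα

theorem QuasiCut.mem_right_iff_of_realizes {ι : Γ → Λ} (hι : StrictMono ι) {δ : QuasiCut Γ} {ξ : Λ}
    (h : Realizes ι δ ξ) (γ : Γ) : γ ∈ δ.right ↔ ξ ≤ ι γ := by
  refine ⟨h.2.1 γ, fun hγ => (δ.mem_right_iff γ).2 ⟨fun α hα => ?_, fun hc α hα => ?_⟩⟩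
  · exact hι.le_iff_le.1 ((h.1 α hα).trans hγ)
  · exact hι.lt_iff_lt.1 (((h.2.2 hc).1 α hα).trans_le hγ)

/-- The quasi-cut of `Γ` defined by an element of an ordered group containing `Γ`. -/
def QuasiCut.ofElement (ι : Γ → Λ) (hι : StrictMono ι) (ξ : Λ) : QuasiCut Γ where
  left := {γ | ι γ ≤ ξ}
  right := {γ | ξ ≤ ι γ}
  left_le_right _ hα _ hβ := hι.le_iff_le.1 (le_trans hα hβ)
  union_eq := Set.eq_univ_of_forall fun γ => le_total (ι γ) ξ

theorem QuasiCut.realizes_ofElement (ι : Γ → Λ) (hι : StrictMono ι) (ξ : Λ) :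
    Realizes ι (QuasiCut.ofElement ι hι ξ) ξ := by
  refine ⟨fun _ h => h, fun _ h => h, fun hc => ⟨fun γ h => ?_, fun γ h => ?_⟩⟩
  -- Equality would put `γ` in both halves, which a cut forbids.
  · exact lt_of_le_of_ne h fun e => lt_irrefl γ (hc γ h γ (Eq.ge e))
  · exact lt_of_le_of_ne h fun e => lt_irrefl γ (hc γ (Eq.ge e) γ h)

theorem map_le_map_iff {ι : Γ → Λ} (hι : StrictMono ι) (x y : WithTop Γ) :
    x.map ι ≤ y.map ι ↔ x ≤ y :=
  WithTop.map_le_iff ι hι.le_iff_le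

end QuasiCut

/-! ### Enlarging the value group; independence of centre and realization. -/

section BaseChange

variable {K Γ Λ : Type u} [Field K] [AddCommGroup Γ] [LinearOrder Γ] [IsOrderedAddMonoid Γ]
  [AddCommGroup Λ] [LinearOrder Λ] [IsOrderedAddMonoid Λ]

/-- The valuation `v` seen with values in an ordered group containing its value group. -/
noncomputable def extendValues (v : AddValuation K (WithTop Γ)) {ι : Γ →+ Λ} (hι : StrictMono ι) :
    AddValuation K (WithTop Λ) :=
  v.map ι.withTopMap rfl hι.monotone.withTop_map

theorem extendValues_apply (v : AddValuation K (WithTop Γ)) {ι : Γ →+ Λ} (hι : StrictMono ι)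
    (c : K) : extendValues v hι c = (v c).map ι := rfl

/-- One criterion for cuts and principal radii alike; it is vacuous when `c = a`. -/
theorem mem_ball_iff (v : AddValuation K (WithTop Γ)) (a c : K) (δ : QuasiCut Γ) :
    c ∈ ball v a δ ↔ ∀ τ : Γ, v (c - a) = τ → τ ∈ δ.right := by
  simp only [ball, Set.mem_ofPred_eq]
  generalize v (c - a) = x
  induction x using WithTop.recTopCoe with
  | top => simp
  | coe x =>
    simp only [WithTop.coe_le_coe, WithTop.coe_lt_coe, WithTop.coe_inj]
    rw [← QuasiCut.mem_right_iff]
    exact ⟨fun h τ e => e ▸ h, fun h => h x rfl⟩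

/-- In a larger value group every ball becomes a closed ball of radius `ξ`, so ultrametric arguments
need not distinguish the kinds of radius. -/
theorem mem_ball_iff_of_realizes {Ξ : Type u} [LinearOrder Ξ]
    (v : AddValuation K (WithTop Γ)) (a c : K) {δ : QuasiCut Γ}
    {ι : Γ → Ξ} (hι : StrictMono ι) {ξ : Ξ} (h : Realizes ι δ ξ) :
    c ∈ ball v a δ ↔ (ξ : WithTop Ξ) ≤ (v (c - a)).map ι := by
  rw [mem_ball_iff]
  generalize v (c - a) = x
  induction x using WithTop.recTopCoe with
  | top => simp
  | coe x =>
    simp only [WithTop.coe_inj, WithTop.map_coe, WithTop.coe_le_coe]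
    rw [← QuasiCut.mem_right_iff_of_realizes hι h]
    exact ⟨fun h => h x rfl, fun h τ e => e ▸ h⟩

theorem monomialValue_congr_center [IsAlgClosed K] (w : AddValuation K (WithTop Λ)) {a b : K}
    {ξ : Λ} (h : (ξ : WithTop Λ) ≤ w (b - a)) (f : K[X]) :
    monomialValue w a ξ f = monomialValue w b ξ f := by
  induction f using polynomial_induction_linear with
  | hC c => rw [monomialValue_C, monomialValue_C]
  | hX d =>
    rw [monomialValue_X_sub_C, monomialValue_X_sub_C]
    apply le_antisymm <;> refine le_min ?_ (min_le_right _ _)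
    · rw [← sub_sub_sub_cancel_right d b a]
      exact w.map_le_sub (min_le_left _ _) ((min_le_right _ _).trans h)
    · rw [← sub_add_sub_cancel d b a]
      exact w.map_le_add (min_le_left _ _) ((min_le_right _ _).trans h)
  | hmul f g hf hg => rw [monomialValue_mul, monomialValue_mul, hf, hg]

theorem monomialValue_extendValues (v : AddValuation K (WithTop Γ)) {ι : Γ →+ Λ}
    (hι : StrictMono ι) (a : K) (γ : Γ) (f : K[X]) :
    monomialValue (extendValues v hι) a (ι γ) f = (monomialValue v a γ f).map ι := by
  refine (isLeast_monomialValue _ a (ι γ) f).unique ?_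
  have h : ∀ n : ℕ, extendValues v hι ((taylor a f).coeff n) + ((n • ι γ : Λ) : WithTop Λ) =
      (v ((taylor a f).coeff n) + ((n • γ : Γ) : WithTop Γ)).map ι := by
    intro n
    rw [WithTop.map_add, WithTop.map_coe, map_nsmul, extendValues_apply]
  simp only [h]
  obtain ⟨⟨n, hn⟩, h₂⟩ := isLeast_monomialValue v a γ f
  refine ⟨⟨n, by simp only; rw [← hn]⟩, ?_⟩
  rintro _ ⟨m, rfl⟩
  exact (map_le_map_iff hι _ _).2 (monomialValue_le v a γ f m)

theorem exists_nsmul_eq_of_isAlgClosed [IsAlgClosed K] (v : AddValuation K (WithTop Γ))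
    (hv : ∀ γ : Γ, ∃ a : K, v a = (γ : WithTop Γ)) (γ : Γ) {n : ℕ} (hn : n ≠ 0) :
    ∃ τ : Γ, n • τ = γ := by
  obtain ⟨a, ha⟩ := hv γ
  obtain ⟨b, rfl⟩ := IsAlgClosed.exists_pow_nat_eq a (Nat.pos_of_ne_zero hn)
  rw [v.map_pow] at ha
  have hb : v b ≠ ⊤ := by
    intro h
    rw [v.top_iff] at h
    rw [h, v.map_zero] at ha
    obtain ⟨m, rfl⟩ := Nat.exists_eq_succ_of_ne_zero hn
    rw [succ_nsmul, add_top] at ha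
    exact WithTop.top_ne_coe ha
  lift v b to Γ using hb with τ
  exact ⟨τ, by exact_mod_cast ha⟩

/-- For `n ≠ 0` divide by `n`: the condition becomes that `γ / n` lies in `δᴸ`. The right-hand side
involves only `δ`, so it transfers between realizations. For `n = 0` the `τ` in the second
alternative is a dummy. -/
theorem le_nsmul_iff (hdiv : ∀ (γ : Γ) {n : ℕ}, n ≠ 0 → ∃ τ : Γ, n • τ = γ) {ι : Γ →+ Λ}
    (hι : StrictMono ι) {δ : QuasiCut Γ} {ξ : Λ} (h : Realizes ι δ ξ) (γ : Γ) (n : ℕ) :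
    ι γ ≤ n • ξ ↔ ∃ τ : Γ, n • τ = γ ∧ τ ∈ δ.left ∨ n = 0 ∧ γ ≤ 0 := by
  rcases eq_or_ne n 0 with rfl | hn
  · constructor
    · intro h'
      refine ⟨0, Or.inr ⟨rfl, ?_⟩⟩
      rwa [zero_nsmul, ← map_zero ι, hι.le_iff_le] at h'
    · rintro ⟨τ, ⟨rfl, _⟩ | ⟨_, h'⟩⟩
      · simp
      · rwa [zero_nsmul, ← map_zero ι, hι.le_iff_le]
  · obtain ⟨τ, rfl⟩ := hdiv γ hn
    rw [map_nsmul, nsmul_le_nsmul_iff_right hn, ← QuasiCut.mem_left_iff_of_realizes hι h]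
    refine ⟨fun h' => ⟨τ, Or.inl ⟨rfl, h'⟩⟩, ?_⟩
    rintro ⟨τ', ⟨e, h'⟩ | ⟨e, _⟩⟩
    · rwa [← nsmul_right_injective hn e]
    · exact absurd e hn

theorem nsmul_le_iff (hdiv : ∀ (γ : Γ) {n : ℕ}, n ≠ 0 → ∃ τ : Γ, n • τ = γ) {ι : Γ →+ Λ}
    (hι : StrictMono ι) {δ : QuasiCut Γ} {ξ : Λ} (h : Realizes ι δ ξ) (γ : Γ) (n : ℕ) :
    n • ξ ≤ ι γ ↔ ∃ τ : Γ, n • τ = γ ∧ τ ∈ δ.right ∨ n = 0 ∧ 0 ≤ γ := by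
  rcases eq_or_ne n 0 with rfl | hn
  · constructor
    · intro h'
      refine ⟨0, Or.inr ⟨rfl, ?_⟩⟩
      rwa [zero_nsmul, ← map_zero ι, hι.le_iff_le] at h'
    · rintro ⟨τ, ⟨rfl, _⟩ | ⟨_, h'⟩⟩
      · simp
      · rwa [zero_nsmul, ← map_zero ι, hι.le_iff_le]
  · obtain ⟨τ, rfl⟩ := hdiv γ hn
    rw [map_nsmul, nsmul_le_nsmul_iff_right hn, ← QuasiCut.mem_right_iff_of_realizes hι h]
    refine ⟨fun h' => ⟨τ, Or.inl ⟨rfl, h'⟩⟩, ?_⟩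
    rintro ⟨τ', ⟨e, h'⟩ | ⟨e, _⟩⟩
    · rwa [← nsmul_right_injective hn e]
    · exact absurd e hn

/-- Cancelling the smaller multiple of `ξ` leaves a comparison of one element of `Γ` with some `k •
ξ`. -/
theorem add_nsmul_le_iff {Ξ : Type u} [AddCommGroup Ξ] [LinearOrder Ξ] [IsOrderedAddMonoid Ξ]
    (hdiv : ∀ (γ : Γ) {n : ℕ}, n ≠ 0 → ∃ τ : Γ, n • τ = γ) {ι : Γ →+ Λ} (hι : StrictMono ι)
    {κ : Γ →+ Ξ} (hκ : StrictMono κ) {δ : QuasiCut Γ} {ξ : Λ} {η : Ξ} (hξ : Realizes ι δ ξ)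
    (hη : Realizes κ δ η) (α β : Γ) (n m : ℕ) :
    ι α + n • ξ ≤ ι β + m • ξ ↔ κ α + n • η ≤ κ β + m • η := by
  rcases le_total n m with h | h
  · obtain ⟨k, rfl⟩ := Nat.exists_eq_add_of_le h
    have e : ∀ {Ω : Type u} [AddCommGroup Ω] [LinearOrder Ω] [IsOrderedAddMonoid Ω] (σ : Γ →+ Ω)
        (ζ : Ω), σ α + n • ζ ≤ σ β + (n + k) • ζ ↔ σ (α - β) ≤ k • ζ := by
      intro Ω _ _ _ σ ζ
      rw [add_nsmul, add_comm (n • ζ), ← add_assoc, add_le_add_iff_right, map_sub,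
        sub_le_iff_le_add, add_comm]
    rw [e, e, le_nsmul_iff hdiv hι hξ, le_nsmul_iff hdiv hκ hη]
  · obtain ⟨k, rfl⟩ := Nat.exists_eq_add_of_le h
    have e : ∀ {Ω : Type u} [AddCommGroup Ω] [LinearOrder Ω] [IsOrderedAddMonoid Ω] (σ : Γ →+ Ω)
        (ζ : Ω), σ α + (m + k) • ζ ≤ σ β + m • ζ ↔ k • ζ ≤ σ (β - α) := by
      intro Ω _ _ _ σ ζ
      rw [add_nsmul, add_comm (m • ζ), ← add_assoc, add_le_add_iff_right, map_sub,
        le_sub_iff_add_le, add_comm]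
    rw [e, e, nsmul_le_iff hdiv hι hξ, nsmul_le_iff hdiv hκ hη]

/-- An inequality between two minima says that some term of `f` is below all terms of `g`, and each
such comparison depends only on `δ`. -/
theorem monomialValue_le_iff_of_realizes {Ξ : Type u} [AddCommGroup Ξ] [LinearOrder Ξ]
    [IsOrderedAddMonoid Ξ] (v : AddValuation K (WithTop Γ))
    (hdiv : ∀ (γ : Γ) {n : ℕ}, n ≠ 0 → ∃ τ : Γ, n • τ = γ) {ι : Γ →+ Λ} (hι : StrictMono ι)
    {κ : Γ →+ Ξ} (hκ : StrictMono κ) {δ : QuasiCut Γ} {ξ : Λ} {η : Ξ} (hξ : Realizes ι δ ξ)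
    (hη : Realizes κ δ η) (a : K) (f g : K[X]) :
    monomialValue (extendValues v hι) a ξ f ≤ monomialValue (extendValues v hι) a ξ g ↔
      monomialValue (extendValues v hκ) a η f ≤ monomialValue (extendValues v hκ) a η g := by
  have key : ∀ {Ω : Type u} [AddCommGroup Ω] [LinearOrder Ω] [IsOrderedAddMonoid Ω]
      (w : AddValuation K (WithTop Ω)) (ζ : Ω),
      monomialValue w a ζ f ≤ monomialValue w a ζ g ↔
      ∃ n : ℕ, ∀ m : ℕ, w ((taylor a f).coeff n) + ((n • ζ : Ω) : WithTop Ω) ≤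
        w ((taylor a g).coeff m) + ((m • ζ : Ω) : WithTop Ω) := by
    intro Ω _ _ _ w ζ
    constructor
    · intro h
      obtain ⟨n, hn⟩ := exists_monomialValue_eq w a ζ f
      exact ⟨n, fun m => hn ▸ h.trans (monomialValue_le w a ζ g m)⟩
    · rintro ⟨n, hn⟩
      exact (monomialValue_le w a ζ f n).trans ((le_monomialValue_iff w a ζ g _).2 hn)
  rw [key, key]
  refine exists_congr fun n => forall_congr' fun m => ?_
  simp only [extendValues_apply]
  generalize v ((taylor a f).coeff n) = x
  generalize v ((taylor a g).coeff m) = y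
  induction y using WithTop.recTopCoe with
  | top => simp
  | coe y =>
    induction x using WithTop.recTopCoe with
    | top => simp only [WithTop.map_top, top_add, top_le_iff, WithTop.map_coe, ← WithTop.coe_add,
        WithTop.coe_ne_top]
    | coe x =>
      simp only [WithTop.map_coe, ← WithTop.coe_add, WithTop.coe_le_coe]
      exact add_nsmul_le_iff hdiv hι hκ hξ hη x y n m

end BaseChange

/-! ### Every quasi-cut is realized in some ordered group. -/

section Realization

variable {Γ : Type u} [AddCommGroup Γ] [LinearOrder Γ] [IsOrderedAddMonoid Γ]

open Filter in
theorem QuasiCut.exists_realizes (δ : QuasiCut Γ) :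
    ∃ (Λ : Type u) (_ : AddCommGroup Λ) (_ : LinearOrder Λ) (_ : IsOrderedAddMonoid Λ)
      (ι : Γ →+ Λ) (_ : StrictMono ι) (ξ : Λ), Realizes ι δ ξ := by
  by_cases hc : δ.IsCut
  swap
  · simp only [QuasiCut.IsCut, not_forall, not_lt] at hc
    obtain ⟨α, hα, β, hβ, hle⟩ := hc
    obtain rfl := le_antisymm (δ.left_le_right α hα β hβ) hle
    exact ⟨Γ, _, _, inferInstance, AddMonoidHom.id Γ, strictMono_id, α,
      fun γ hγ => δ.left_le_right γ hγ α hβ, fun γ hγ => δ.left_le_right α hα γ hγ,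
      fun hc => absurd (hc α hα α hβ) (lt_irrefl _)⟩
  suffices h : ∃ (Λ : Type u) (_ : AddCommGroup Λ) (_ : LinearOrder Λ) (_ : IsOrderedAddMonoid Λ)
      (ι : Γ →+ Λ) (_ : StrictMono ι) (ξ : Λ),
      (∀ γ ∈ δ.left, ι γ < ξ) ∧ (∀ γ ∈ δ.right, ξ < ι γ) by
    obtain ⟨Λ, i₁, i₂, i₃, ι, hι, ξ, h₁, h₂⟩ := h
    exact ⟨Λ, i₁, i₂, i₃, ι, hι, ξ, fun γ hγ => (h₁ γ hγ).le, fun γ hγ => (h₂ γ hγ).le,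
      fun _ => ⟨h₁, h₂⟩⟩
  by_cases hL : δ.left.Nonempty
  · have : Nonempty δ.left := hL.to_subtype
    -- The group is an ultrapower of `Γ ×ₗ ℤ` over `δᴸ`, along an ultrafilter containing all final
    -- segments. The element `ξ` is the class of `α ↦ (α, 1)`; the coordinate `1` keeps it strictly
    -- above `δᴸ` even when `δᴸ` has a maximum.
    let φ : Ultrafilter δ.left := Ultrafilter.of atTop
    have hφ : (φ : Filter δ.left) ≤ atTop := Ultrafilter.of_le atTop
    let ι₀ : Γ →+ Γ ×ₗ ℤ :=
      { toFun := fun γ => toLex (γ, 0), map_zero' := rfl, map_add' := fun _ _ => rfl }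
    have hι₀ : StrictMono ι₀ := fun x y h => Prod.Lex.toLex_lt_toLex.2 (Or.inl h)
    let ι : Γ →+ Germ (φ : Filter δ.left) (Γ ×ₗ ℤ) :=
      { toFun := fun γ => ((ι₀ γ : Γ ×ₗ ℤ) : Germ (φ : Filter δ.left) (Γ ×ₗ ℤ))
        map_zero' := rfl
        map_add' := fun x y => by rw [map_add]; rfl }
    refine ⟨Germ (φ : Filter δ.left) (Γ ×ₗ ℤ), inferInstance, inferInstance, inferInstance, ι,
      fun x y h => Germ.const_lt (hι₀ h),
      ((fun α : δ.left => (toLex (α.1, 1) : Γ ×ₗ ℤ)) : δ.left → Γ ×ₗ ℤ), fun γ hγ => ?_,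
      fun γ hγ => ?_⟩
    · refine Germ.coe_lt.2 ?_
      filter_upwards [hφ (mem_atTop (⟨γ, hγ⟩ : δ.left))] with α hα
      rcases (show γ ≤ α.1 from hα).lt_or_eq with h | h
      · exact Prod.Lex.toLex_lt_toLex.2 (Or.inl h)
      · exact Prod.Lex.toLex_lt_toLex.2 (Or.inr ⟨h, zero_lt_one⟩)
    · exact Germ.coe_lt.2 (Eventually.of_forall fun α =>
        Prod.Lex.toLex_lt_toLex.2 (Or.inl (hc α.1 α.2 γ hγ)))
  -- With `δᴸ` empty, `ξ` must lie below all of `Γ`: a dominant coordinate `-1` achieves this.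
  · let ι : Γ →+ ℤ ×ₗ Γ :=
      { toFun := fun γ => toLex (0, γ), map_zero' := rfl, map_add' := fun _ _ => rfl }
    refine ⟨ℤ ×ₗ Γ, inferInstance, inferInstance, inferInstance, ι,
      fun x y h => Prod.Lex.toLex_lt_toLex.2 (Or.inr ⟨rfl, h⟩), toLex (-1, 0),
      fun γ hγ => absurd ⟨γ, hγ⟩ hL, fun γ _ => Prod.Lex.toLex_lt_toLex.2 (Or.inl (by simp))⟩

end Realization

/-! ### Closed balls, and the limit valuation of a nest. -/

section StableLimit

variable {K Γ : Type u} [Field K] [AddCommGroup Γ] [LinearOrder Γ] [IsOrderedAddMonoid Γ]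

theorem mem_closedBall_self (v : AddValuation K (WithTop Γ)) (a : K) (γ : Γ) :
    a ∈ closedBall v a γ := by
  simp [closedBall]

theorem mem_closedBall_iff (v : AddValuation K (WithTop Γ)) (a c : K) (γ : Γ) :
    c ∈ closedBall v a γ ↔ (γ : WithTop Γ) ≤ v (c - a) := Iff.rfl

/-- The smaller ball contains two points whose difference has value exactly `η`, by surjectivity of
`v` onto `Γ`. -/
theorem radius_le_of_closedBall_subset {v : AddValuation K (WithTop Γ)}
    (hv : ∀ γ : Γ, ∃ a : K, v a = (γ : WithTop Γ)) {a b : K} {γ η : Γ}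
    (h : closedBall v b η ⊆ closedBall v a γ) : γ ≤ η := by
  obtain ⟨e, he⟩ := hv η
  have h₁ := h (mem_closedBall_self v b η)
  have h₂ : b + e ∈ closedBall v a γ := h (by simp [closedBall, he])
  rw [mem_closedBall_iff] at h₁ h₂
  have h₃ := v.map_le_sub h₂ h₁
  rw [sub_sub_sub_cancel_right, add_sub_cancel_left, he] at h₃
  exact_mod_cast h₃

theorem monomialValue_le_of_closedBall_subset [IsAlgClosed K] {v : AddValuation K (WithTop Γ)}
    (hv : ∀ γ : Γ, ∃ a : K, v a = (γ : WithTop Γ)) {a b : K} {γ η : Γ}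
    (h : closedBall v b η ⊆ closedBall v a γ) (f : K[X]) :
    monomialValue v a γ f ≤ monomialValue v b η f := by
  rw [monomialValue_congr_center v (h (mem_closedBall_self v b η))]
  exact monomialValue_mono v b (radius_le_of_closedBall_subset hv h) f

theorem map_sub_eq_of_notMem_closedBall {v : AddValuation K (WithTop Γ)} {a c d : K} {γ : Γ}
    (hd : d ∉ closedBall v a γ) (hc : c ∈ closedBall v a γ) : v (d - c) = v (d - a) := by
  rw [mem_closedBall_iff, not_le] at hd
  rw [← sub_sub_sub_cancel_right d c a]
  exact v.map_sub_eq_of_lt_left (hd.trans_le hc)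

theorem monomialValue_X_sub_C_of_notMem {v : AddValuation K (WithTop Γ)}
    (hv : ∀ γ : Γ, ∃ a : K, v a = (γ : WithTop Γ)) {a b d : K} {γ η : Γ}
    (hd : d ∉ closedBall v a γ) (h : closedBall v b η ⊆ closedBall v a γ) :
    monomialValue v b η (X - C d) = v (d - a) := by
  rw [monomialValue_X_sub_C,
    map_sub_eq_of_notMem_closedBall hd (h (mem_closedBall_self v b η)), min_eq_left]
  rw [mem_closedBall_iff, not_le] at hd
  exact hd.le.trans (WithTop.coe_le_coe.2 (radius_le_of_closedBall_subset hv h))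

attribute [local instance] Nest.linearOrder

namespace Nest

variable {v : AddValuation K (WithTop Γ)} (B : Nest v)

theorem toSet_anti {i j : B.Index} (h : i ≤ j) : B.toSet j ⊆ B.toSet i := by
  rcases h.lt_or_eq with h | rfl
  · exact ((B.lt_iff_ssubset i j).1 h).1
  · exact subset_rfl

theorem nonempty_index : Nonempty B.Index := by
  by_contra h
  rw [not_nonempty_iff] at h
  have := B.iInter_eq_empty
  rw [Set.iInter_of_empty] at this
  exact Set.univ_nonempty.ne_empty this

theorem exists_notMem (d : K) : ∃ i, d ∉ B.toSet i := by
  by_contra h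
  push Not at h
  have : d ∈ ⋂ i, B.toSet i := Set.mem_iInter.2 h
  rw [B.iInter_eq_empty] at this
  exact this

-- Since the intersection is empty, some ball misses `d`; from there on the value at `X - C d` is
-- constant. Products inherit eventual constancy.
open Filter in
theorem exists_eventually_eq [IsAlgClosed K] (hv : ∀ γ : Γ, ∃ a : K, v a = (γ : WithTop Γ))
    {a : B.Index → K} {γ : B.Index → Γ} (hB : ∀ i, B.toSet i = closedBall v (a i) (γ i))
    (f : K[X]) : ∃ y, ∀ᶠ i in atTop, monomialValue v (a i) (γ i) f = y := by
  have := B.nonempty_index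
  induction f using polynomial_induction_linear with
  | hC c => exact ⟨v c, Eventually.of_forall fun i => monomialValue_C v _ _ c⟩
  | hX d =>
    obtain ⟨i, hi⟩ := B.exists_notMem d
    rw [hB i] at hi
    refine ⟨v (d - a i), ?_⟩
    filter_upwards [mem_atTop i] with j hj
    exact monomialValue_X_sub_C_of_notMem hv hi (hB i ▸ hB j ▸ B.toSet_anti hj)
  | hmul f g hf hg =>
    obtain ⟨y, hy⟩ := hf
    obtain ⟨z, hz⟩ := hg
    refine ⟨y + z, ?_⟩
    filter_upwards [hy, hz] with i h₁ h₂
    rw [monomialValue_mul, h₁, h₂]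

-- Each valuation axiom holds at every index and so passes to the eventual values. Monotonicity
-- along the nest makes the eventual value a maximum.
open Filter in
theorem exists_isStableLimit [IsAlgClosed K] (hv : ∀ γ : Γ, ∃ a : K, v a = (γ : WithTop Γ)) :
    ∃ p : ValSpace v, p.IsStableLimit B := by
  have := B.nonempty_index
  choose a γ hB using B.exists_eq_closedBall
  choose w hw using B.exists_eventually_eq hv hB
  have limit_eq : ∀ {f : K[X]} {y}, (∀ᶠ i in atTop, monomialValue v (a i) (γ i) f = y) →
      w f = y := fun {f} y h => by
    obtain ⟨i, h₁, h₂⟩ := ((hw f).and h).exists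
    rw [← h₁, h₂]
  have hC : ∀ c, w (C c) = v c := fun c =>
    limit_eq (Eventually.of_forall fun i => monomialValue_C v _ _ c)
  obtain ⟨W, hW⟩ := exists_extend_ratFunc
    (AddValuation.of w (by rw [← C_0, hC, v.map_zero]) (by rw [← C_1, hC, v.map_one])
      (fun f g => by
        obtain ⟨i, ⟨h₁, h₂⟩, h₃⟩ := (((hw f).and (hw g)).and (hw (f + g))).exists
        rw [← h₁, ← h₂, ← h₃]
        exact min_le_monomialValue_add v _ _ f g)
      (fun f g => limit_eq (by
        filter_upwards [hw f, hw g] with i h₁ h₂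
        rw [monomialValue_mul, h₁, h₂])))
    (fun f hf => by
      obtain ⟨i, hi⟩ := (hw f).exists
      exact (monomialValue_eq_top_iff v _ _ f).1 (hi.trans hf))
  have hWC : ∀ c : K, W (RatFunc.C c) = v c := fun c => by
    rw [← RatFunc.algebraMap_C, hW]
    exact hC c
  refine ⟨_, W, hWC, rfl, fun f => ?_⟩
  rw [hW]
  constructor
  · obtain ⟨i, hi⟩ := (hw f).exists
    exact ⟨i, a i, γ i, hB i, hi.symm⟩
  · rintro _ ⟨i, b, η, hi, rfl⟩
    obtain ⟨j, hj, hij⟩ := ((hw f).and (mem_atTop i)).exists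
    rw [AddValuation.of_apply, ← hj]
    exact monomialValue_le_of_closedBall_subset hv (hi ▸ hB j ▸ B.toSet_anti hij) f

end Nest

end StableLimit

/-! ### Monomial valuations on rational functions. -/

section Monomial

variable {K Γ : Type u} [Field K] [AddCommGroup Γ] [LinearOrder Γ] [IsOrderedAddMonoid Γ]

theorem ValExt.isEquiv_of_map_C (v : AddValuation K (WithTop Γ)) {Λ : Type u} [AddCommGroup Λ]
    [LinearOrder Λ] [IsOrderedAddMonoid Λ] (W : AddValuation (RatFunc K) (WithTop Λ))
    {ι : Γ →+ Λ} (hι : StrictMono ι) (hW : ∀ c : K, W (RatFunc.C c) = (v c).map ι) :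
    (W.comap (RatFunc.C : K →+* RatFunc K)).IsEquiv v := fun c d => by
  change W (RatFunc.C d) ≤ W (RatFunc.C c) ↔ v d ≤ v c
  rw [hW, hW, map_le_map_iff hι]

theorem exists_isMonomial (v : AddValuation K (WithTop Γ)) (a : K) (δ : QuasiCut Γ) :
    ∃ p : ValSpace v, p.IsMonomial a δ := by
  obtain ⟨Λ, _, _, _, ι, hι, ξ, hξ⟩ := δ.exists_realizes
  obtain ⟨W, hW⟩ := exists_extend_ratFunc (monomialVal (extendValues v hι) a ξ)
    (fun f hf => (monomialValue_eq_top_iff _ a ξ f).1 hf)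
  have hWC : ∀ c : K, W (RatFunc.C c) = (v c).map ι := fun c => by
    rw [← RatFunc.algebraMap_C, hW]
    exact monomialValue_C _ a ξ c
  refine ⟨_, { Val := Λ, val := W, isEquiv := ValExt.isEquiv_of_map_C v W hι hWC }, rfl, ι, hι,
    hWC, ξ, hξ, fun f => ?_⟩
  rw [hW]
  exact isLeast_monomialValue (extendValues v hι) a ξ f

/-- The valuation `μ` is the monomial valuation `ω_{a,ξ}` with values in the group of `μ`, which
contains `Γ` through `ι`. -/
structure IsMonomialAt {v : AddValuation K (WithTop Γ)} (μ : ValExt v) (a : K) (δ : QuasiCut Γ)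
    (ι : Γ →+ μ.Val) (ξ : μ.Val) : Prop where
  strictMono : StrictMono ι
  map_C : ∀ c : K, μ.val (RatFunc.C c) = (v c).map ι
  realizes : Realizes ι δ ξ
  map_polynomial : ∀ f : K[X], μ.val (algebraMap K[X] (RatFunc K) f) =
    monomialValue (extendValues v strictMono) a ξ f

theorem ValSpace.isMonomial_iff {v : AddValuation K (WithTop Γ)} {p : ValSpace v} {a : K}
    {δ : QuasiCut Γ} :
    p.IsMonomial a δ ↔ ∃ μ : ValExt v, Quotient.mk (ValExt.setoid v) μ = p ∧
      ∃ (ι : Γ →+ μ.Val) (ξ : μ.Val), IsMonomialAt μ a δ ι ξ := by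
  constructor
  · rintro ⟨μ, h, ι, hι, hC, ξ, hξ, hf⟩
    exact ⟨μ, h, ι, ξ, hι, hC, hξ, fun f =>
      (hf f).unique (isLeast_monomialValue (extendValues v hι) a ξ f)⟩
  · rintro ⟨μ, h, ι, ξ, hι, hC, hξ, hf⟩
    exact ⟨μ, h, ι, hι, hC, ξ, hξ, fun f => by
      rw [hf]; exact isLeast_monomialValue (extendValues v hι) a ξ f⟩

end Monomial

/-! ### The order on valuations compared with the order on balls. -/

section Order

variable {K Γ : Type u} [Field K] [AddCommGroup Γ] [LinearOrder Γ] [IsOrderedAddMonoid Γ]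

attribute [local instance] Nest.linearOrder

/-- The equivalence class of a valuation. -/
def ValExt.toSpace {v : AddValuation K (WithTop Γ)} (μ : ValExt v) : ValSpace v :=
  Quotient.mk (ValExt.setoid v) μ

/-- The valuation `μ` is the stable limit `ω_𝓑`, with values in a group which contains `Γ`
through `ι`. -/
structure IsStableLimitAt {v : AddValuation K (WithTop Γ)} (μ : ValExt v) (B : Nest v)
    (ι : Γ →+ μ.Val) : Prop where
  strictMono : StrictMono ι
  map_C : ∀ c : K, μ.val (RatFunc.C c) = (v c).map ι
  exists_eq : ∀ f : K[X], ∃ (i : B.Index) (a : K) (γ : Γ), B.toSet i = closedBall v a γ ∧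
    μ.val (algebraMap K[X] (RatFunc K) f) = (monomialValue v a γ f).map ι
  le : ∀ (f : K[X]) (i : B.Index) (a : K) (γ : Γ), B.toSet i = closedBall v a γ →
    (monomialValue v a γ f).map ι ≤ μ.val (algebraMap K[X] (RatFunc K) f)

theorem ValSpace.IsStableLimit.exists_at {v : AddValuation K (WithTop Γ)} {p : ValSpace v}
    {B : Nest v} (h : p.IsStableLimit B) :
    ∃ μ : ValExt v, μ.toSpace = p ∧ ∃ ι : Γ →+ μ.Val,
      IsStableLimitAt μ B ι := by
  obtain ⟨w, hw, hp, hf⟩ := h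
  refine ⟨_, hp, AddMonoidHom.id Γ, strictMono_id, fun c => ?_, fun f => ?_, fun f i a γ h => ?_⟩
  · exact (hw c).trans (congrFun WithTop.map_id (v c)).symm
  · obtain ⟨i, a, γ, h₁, h₂⟩ := (hf f).1
    exact ⟨i, a, γ, h₁, h₂.trans (congrFun WithTop.map_id _).symm⟩
  · exact (congrFun WithTop.map_id _).le.trans ((hf f).2 ⟨i, a, γ, h, rfl⟩)

theorem ValExt.isEquiv_of_polynomial {v : AddValuation K (WithTop Γ)} {μ ν : ValExt v}
    (h : ∀ f g : K[X],
      μ.val (algebraMap K[X] (RatFunc K) f) ≤ μ.val (algebraMap K[X] (RatFunc K) g) ↔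
      ν.val (algebraMap K[X] (RatFunc K) f) ≤ ν.val (algebraMap K[X] (RatFunc K) g)) :
    μ.val.IsEquiv ν.val := by
  have scale : ∀ (ρ : ValExt v) (r s t : RatFunc K), t ≠ 0 →
      (ρ.val r ≤ ρ.val s ↔ ρ.val (r * t) ≤ ρ.val (s * t)) := by
    intro ρ r s t ht
    rw [ρ.val.map_mul, ρ.val.map_mul]
    exact (WithTop.add_le_add_iff_right (ρ.val.ne_top_iff.2 ht)).symm
  suffices h : ∀ r s : RatFunc K, μ.val r ≤ μ.val s ↔ ν.val r ≤ ν.val s from fun r s => h s r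
  intro r s
  obtain ⟨f, g, hg, rfl⟩ := IsFractionRing.div_surjective (A := K[X]) r
  obtain ⟨k, l, hl, rfl⟩ := IsFractionRing.div_surjective (A := K[X]) s
  have hg' := RatFunc.algebraMap_ne_zero (nonZeroDivisors.ne_zero hg)
  have hl' := RatFunc.algebraMap_ne_zero (nonZeroDivisors.ne_zero hl)
  have e₁ : algebraMap K[X] (RatFunc K) f / algebraMap K[X] (RatFunc K) g *
      (algebraMap K[X] (RatFunc K) g * algebraMap K[X] (RatFunc K) l) =
      algebraMap K[X] (RatFunc K) (f * l) := by
    rw [map_mul]; field_simp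
  have e₂ : algebraMap K[X] (RatFunc K) k / algebraMap K[X] (RatFunc K) l *
      (algebraMap K[X] (RatFunc K) g * algebraMap K[X] (RatFunc K) l) =
      algebraMap K[X] (RatFunc K) (k * g) := by
    rw [map_mul]; field_simp
  rw [scale μ _ _ _ (mul_ne_zero hg' hl'), scale ν _ _ _ (mul_ne_zero hg' hl'), e₁, e₂]
  exact h _ _

variable {v : AddValuation K (WithTop Γ)} (hv : ∀ γ : Γ, ∃ a : K, v a = (γ : WithTop Γ))
  {μ ν : ValExt v} {ι : Γ →+ μ.Val} {κ : Γ →+ ν.Val}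

include hv in
-- Both forms of `≤` preserve comparisons with constants, and every `γ` is the value of a constant.
theorem ValExt.cut_le_of_toSpace_le (hμ : ∀ c : K, μ.val (RatFunc.C c) = (v c).map ι)
    (hν : ∀ c : K, ν.val (RatFunc.C c) = (v c).map κ)
    (h : μ.toSpace ≤ ν.toSpace)
    {f : K[X]} (hf : f ≠ 0) (γ : Γ) :
    ((ι γ : WithTop μ.Val) ≤ μ.val (algebraMap K[X] (RatFunc K) f) →
      (κ γ : WithTop ν.Val) ≤ ν.val (algebraMap K[X] (RatFunc K) f)) ∧
    (ν.val (algebraMap K[X] (RatFunc K) f) ≤ (κ γ : WithTop ν.Val) →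
      μ.val (algebraMap K[X] (RatFunc K) f) ≤ (ι γ : WithTop μ.Val)) := by
  obtain ⟨c, hc⟩ := hv γ
  have h₁ : (ι γ : WithTop μ.Val) = μ.val (RatFunc.C c) := by rw [hμ, hc, WithTop.map_coe]
  have h₂ : (κ γ : WithTop ν.Val) = ν.val (RatFunc.C c) := by rw [hν, hc, WithTop.map_coe]
  rw [h₁, h₂]
  rcases h with h | h
  · have h : μ.val.IsEquiv ν.val := Quotient.exact h
    exact ⟨(h _ _).1, (h _ _).2⟩
  · obtain ⟨e, -, l₁, l₂⟩ := (show μ.Below ν from h) f hf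
    exact ⟨fun h => ((μ.le_iff ν c e).1 (h.trans l₁)).trans l₂,
      fun h => l₁.trans ((μ.le_iff ν e c).2 (l₂.trans h))⟩

include hv in
-- The intermediate monomial value of a nonzero `f` lies in `Γ`, hence is `v c` for some `c ≠ 0`, as
-- `ValExt.Below` demands.
theorem ValExt.toSpace_le_of_between (hμ : ∀ c : K, μ.val (RatFunc.C c) = (v c).map ι)
    (hν : ∀ c : K, ν.val (RatFunc.C c) = (v c).map κ)
    (h : ∀ f : K[X], ∃ (b : K) (γ : Γ),
      μ.val (algebraMap K[X] (RatFunc K) f) ≤ (monomialValue v b γ f).map ι ∧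
      (monomialValue v b γ f).map κ ≤ ν.val (algebraMap K[X] (RatFunc K) f)) :
    μ.toSpace ≤ ν.toSpace := by
  refine Or.inr (show μ.Below ν from fun f hf => ?_)
  obtain ⟨b, γ, h₁, h₂⟩ := h f
  have hne := mt (monomialValue_eq_top_iff v b γ f).1 hf
  lift monomialValue v b γ f to Γ using hne with x
  obtain ⟨c, hc⟩ := hv x
  refine ⟨c, fun h => ?_, ?_, ?_⟩
  · rw [h, v.map_zero] at hc
    exact WithTop.top_ne_coe hc
  · rwa [hμ, hc]
  · rwa [hν, hc]

theorem IsMonomialAt.map_X_sub_C {a : K} {δ : QuasiCut Γ} {ξ : μ.Val}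
    (h : IsMonomialAt μ a δ ι ξ) (d : K) :
    μ.val (algebraMap K[X] (RatFunc K) (X - C d)) = min ((v (d - a)).map ι) (ξ : WithTop μ.Val) := by
  rw [h.map_polynomial, monomialValue_X_sub_C, extendValues_apply]

theorem IsMonomialAt.map_X_sub_C_self {a : K} {δ : QuasiCut Γ} {ξ : μ.Val}
    (h : IsMonomialAt μ a δ ι ξ) :
    μ.val (algebraMap K[X] (RatFunc K) (X - C a)) = ξ := by
  rw [h.map_X_sub_C, sub_self, v.map_zero, WithTop.map_top, min_eq_right le_top]

theorem IsMonomialAt.center_change [IsAlgClosed K] {a b : K} {δ : QuasiCut Γ} {ξ : μ.Val}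
    (h : IsMonomialAt μ a δ ι ξ) (hb : b ∈ ball v a δ) : IsMonomialAt μ b δ ι ξ :=
  ⟨h.strictMono, h.map_C, h.realizes, fun f => by
    rw [h.map_polynomial]
    exact monomialValue_congr_center _
      ((mem_ball_iff_of_realizes v a b h.strictMono h.realizes).1 hb) f⟩

theorem mem_ball_self (v : AddValuation K (WithTop Γ)) (a : K) (δ : QuasiCut Γ) :
    a ∈ ball v a δ := by
  simp [mem_ball_iff]

include hv in
theorem IsMonomialAt.toSpace_le_iff [IsAlgClosed K] {a b : K} {δ ε : QuasiCut Γ} {ξ : μ.Val}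
    {η : ν.Val} (hμ : IsMonomialAt μ a δ ι ξ) (hν : IsMonomialAt ν b ε κ η) :
    μ.toSpace ≤ ν.toSpace ↔
      pointedBall v a δ ≤ pointedBall v b ε := by
  constructor
  · intro h
    -- The single polynomial `X - C a` suffices: its values are `ξ` under `μ` and `min (v (a - b))
    -- η` under `ν`.
    have cut := fun γ => ValExt.cut_le_of_toSpace_le hv hμ.map_C hν.map_C h (X_sub_C_ne_zero a) γ
    rw [hμ.map_X_sub_C_self, hν.map_X_sub_C] at cut
    refine ⟨fun c hc => (mem_ball_iff v a c δ).2 fun τ hτ => ?_, fun γ hγ => ?_, fun γ hγ => ?_⟩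
    · refine (QuasiCut.mem_right_iff_of_realizes hμ.strictMono hμ.realizes τ).2
        (WithTop.coe_le_coe.1 ((cut τ).2 ?_))
      rw [← WithTop.map_coe, ← hτ, ← sub_sub_sub_cancel_right c a b, ← extendValues_apply v hν.strictMono,
        ← extendValues_apply v hν.strictMono]
      exact (extendValues v hν.strictMono).map_le_sub ((min_le_right _ _).trans
        ((mem_ball_iff_of_realizes v b c hν.strictMono hν.realizes).1 hc)) (min_le_left _ _)
    · refine (QuasiCut.mem_left_iff_of_realizes hν.strictMono hν.realizes γ).2
        (WithTop.coe_le_coe.1 (((cut γ).1 ?_).trans (min_le_right _ _)))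
      exact WithTop.coe_le_coe.2 (hμ.realizes.1 γ hγ)
    · refine (QuasiCut.mem_right_iff_of_realizes hμ.strictMono hμ.realizes γ).2
        (WithTop.coe_le_coe.1 ((cut γ).2 ((min_le_right _ _).trans ?_)))
      exact WithTop.coe_le_coe.2 (hν.realizes.2.1 γ hγ)
  · rintro ⟨hsub, hle⟩
    replace hμ := hμ.center_change (hsub (mem_ball_self v b ε))
    by_cases hδ : δ = ε
    · subst hδ
      refine Or.inl (Quotient.sound (s := ValExt.setoid v) (ValExt.isEquiv_of_polynomial fun f g => ?_))
      rw [hμ.map_polynomial, hμ.map_polynomial, hν.map_polynomial, hν.map_polynomial]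
      exact monomialValue_le_iff_of_realizes v (exists_nsmul_eq_of_isAlgClosed v hv) hμ.strictMono
        hν.strictMono hμ.realizes hν.realizes b f g
    -- If `εᴸ` and `δᴿ` were disjoint, then `ε ≤ δ`, and the radii would coincide.
    · obtain ⟨γ, hγε, hγδ⟩ : ∃ γ, γ ∈ ε.left ∧ γ ∈ δ.right := by
        by_contra! hne
        refine hδ (hle.antisymm ⟨fun γ hγ => ?_, fun γ hγ => ?_⟩)
        · exact (δ.union_eq ▸ Set.mem_univ γ : γ ∈ δ.left ∪ δ.right).resolve_right (hne γ hγ)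
        · exact (ε.union_eq ▸ Set.mem_univ γ : γ ∈ ε.left ∪ ε.right).resolve_left
            fun h => hne γ h hγ
      refine ValExt.toSpace_le_of_between hv hμ.map_C hν.map_C fun f => ⟨b, γ, ?_, ?_⟩
      · rw [hμ.map_polynomial, ← monomialValue_extendValues v hμ.strictMono]
        exact monomialValue_mono _ b (hμ.realizes.2.1 γ hγδ) f
      · rw [hν.map_polynomial, ← monomialValue_extendValues v hν.strictMono]
        exact monomialValue_mono _ b (hν.realizes.1 γ hγε) f

include hv in
theorem IsStableLimitAt.map_X_sub_C [IsAlgClosed K] {B : Nest v} (h : IsStableLimitAt μ B ι)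
    {i : B.Index} {b d : K} {γ : Γ} (hi : B.toSet i = closedBall v b γ)
    (hd : d ∉ closedBall v b γ) :
    μ.val (algebraMap K[X] (RatFunc K) (X - C d)) = (v (d - b)).map ι := by
  have hbd := monomialValue_X_sub_C_of_notMem hv hd subset_rfl
  apply le_antisymm
  · obtain ⟨j, a, η, hj, e⟩ := h.exists_eq (X - C d)
    rw [e, map_le_map_iff h.strictMono]
    rcases le_total i j with hij | hij
    · exact (monomialValue_X_sub_C_of_notMem hv hd (hi ▸ hj ▸ B.toSet_anti hij)).le
    · rw [← hbd]
      exact monomialValue_le_of_closedBall_subset hv (hi ▸ hj ▸ B.toSet_anti hij) _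
  · rw [← hbd]
    exact h.le _ i b γ hi

theorem IsStableLimitAt.le_map_X_sub_C {B : Nest v} (h : IsStableLimitAt μ B ι)
    {i : B.Index} {b d : K} {γ : Γ} (hi : B.toSet i = closedBall v b γ)
    (hd : d ∈ closedBall v b γ) :
    (ι γ : WithTop μ.Val) ≤ μ.val (algebraMap K[X] (RatFunc K) (X - C d)) := by
  refine le_trans ?_ (h.le _ i b γ hi)
  rw [monomialValue_X_sub_C, min_eq_right hd, WithTop.map_coe]

include hv in
theorem IsMonomialAt.toSpace_le_iff_exists_subset [IsAlgClosed K] {a : K} {δ : QuasiCut Γ}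
    {ξ : μ.Val} {B : Nest v} (hμ : IsMonomialAt μ a δ ι ξ) (hν : IsStableLimitAt ν B κ) :
    μ.toSpace ≤ ν.toSpace ↔
      ∃ i, B.toSet i ⊆ ball v a δ := by
  constructor
  · intro h
    -- On a ball missing `a`, every `c` has the same `v (c - a)`, equal to the value of `X - C a`
    -- under `ν`.
    obtain ⟨i, ha⟩ := B.exists_notMem a
    obtain ⟨b, γ, hi⟩ := B.exists_eq_closedBall i
    rw [hi] at ha
    refine ⟨i, fun c hc => (mem_ball_iff v a c δ).2 fun τ hτ => ?_⟩
    rw [hi] at hc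
    have cut := ValExt.cut_le_of_toSpace_le hv hμ.map_C hν.map_C h (X_sub_C_ne_zero a) τ
    rw [hμ.map_X_sub_C_self, hν.map_X_sub_C hv hi ha, ← map_sub_eq_of_notMem_closedBall ha hc,
      v.map_sub_swap, hτ] at cut
    exact (QuasiCut.mem_right_iff_of_realizes hμ.strictMono hμ.realizes τ).2
      (WithTop.coe_le_coe.1 (cut.2 le_rfl))
  · rintro ⟨i, hsub⟩
    obtain ⟨b, γ, hi⟩ := B.exists_eq_closedBall i
    rw [hi] at hsub
    have hb := hsub (mem_closedBall_self v b γ)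
    have hγ : ξ ≤ ι γ := by
      obtain ⟨e, he⟩ := hv γ
      have hbe : b + e ∈ ball v a δ := hsub (by simp [closedBall, he])
      rw [mem_ball_iff_of_realizes v a _ hμ.strictMono hμ.realizes] at hb hbe
      have := (extendValues v hμ.strictMono).map_le_sub hbe hb
      rw [sub_sub_sub_cancel_right, add_sub_cancel_left, extendValues_apply, he] at this
      exact WithTop.coe_le_coe.1 this
    replace hμ := hμ.center_change hb
    refine ValExt.toSpace_le_of_between hv hμ.map_C hν.map_C fun f => ⟨b, γ, ?_, hν.le f i b γ hi⟩
    rw [hμ.map_polynomial, ← monomialValue_extendValues v hμ.strictMono]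
    exact monomialValue_mono _ b hγ f

include hv in
-- Let `B(b, γ)` be a ball of the nest missing `a`. Then `μ(x - b) ≥ γ`, whereas `ν(x - b) ≤ v (b -
-- a) < γ`.
theorem IsStableLimitAt.not_toSpace_le {a : K} {δ : QuasiCut Γ} {η : ν.Val} {B : Nest v}
    (hμ : IsStableLimitAt μ B ι) (hν : IsMonomialAt ν a δ κ η) :
    ¬ μ.toSpace ≤ ν.toSpace := by
  intro h
  obtain ⟨i, ha⟩ := B.exists_notMem a
  obtain ⟨b, γ, hi⟩ := B.exists_eq_closedBall i
  rw [hi, mem_closedBall_iff, v.map_sub_swap] at ha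
  have h' := (ValExt.cut_le_of_toSpace_le hv hμ.map_C hν.map_C h (X_sub_C_ne_zero b) γ).1
    (hμ.le_map_X_sub_C hi (mem_closedBall_self v b γ))
  rw [hν.map_X_sub_C] at h'
  exact ha ((map_le_map_iff hν.strictMono _ _).1 (h'.trans (min_le_left _ _)))

include hv in
theorem IsStableLimitAt.toSpace_le_iff [IsAlgClosed K] {B D : Nest v}
    (hμ : IsStableLimitAt μ B ι) (hν : IsStableLimitAt ν D κ) :
    μ.toSpace ≤ ν.toSpace ↔ B ≈ D := by
  constructor
  · intro h
    have fine : ∀ i, ∃ j, D.toSet j ⊆ B.toSet i := by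
      intro i
      obtain ⟨a, γ, hi⟩ := B.exists_eq_closedBall i
      -- When `D_j = B(b, η)` misses `a`, `ν(x - a) = v (a - b)`. This value is at least `γ`, and
      -- all points of `D_j` are equally far from `a`.
      obtain ⟨j, ha⟩ := D.exists_notMem a
      obtain ⟨b, η, hj⟩ := D.exists_eq_closedBall j
      rw [hj] at ha
      have h' := (ValExt.cut_le_of_toSpace_le hv hμ.map_C hν.map_C h (X_sub_C_ne_zero a) γ).1
        (hμ.le_map_X_sub_C hi (mem_closedBall_self v a γ))
      rw [hν.map_X_sub_C hv hj ha] at h'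
      refine ⟨j, fun c hc => ?_⟩
      rw [hj] at hc
      rw [hi, mem_closedBall_iff, v.map_sub_swap, map_sub_eq_of_notMem_closedBall ha hc]
      exact (map_le_map_iff hν.strictMono _ _).1 h'
    refine ⟨fine, fun j => ?_⟩
    obtain ⟨b, η, hj⟩ := D.exists_eq_closedBall j
    -- The reverse cofinality needs no second inequality. Each `B_i` meets `D_j`, because it
    -- contains some `D_k`; if no `B_i` fits inside `D_j`, every `B_i` contains the centre `b`,
    -- against the empty intersection.
    by_contra! hne
    refine Set.eq_empty_iff_forall_notMem.1 B.iInter_eq_empty b (Set.mem_iInter.2 fun i => ?_)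
    obtain ⟨a, γ, hi⟩ := B.exists_eq_closedBall i
    obtain ⟨k, hk⟩ := fine i
    obtain ⟨c, hcj, hci⟩ : ∃ c, c ∈ D.toSet j ∧ c ∈ B.toSet i := by
      have hne : ∀ l, (D.toSet l).Nonempty := fun l => by
        obtain ⟨d, ρ, hl⟩ := D.exists_eq_closedBall l
        exact ⟨d, hl ▸ mem_closedBall_self v d ρ⟩
      rcases le_total j k with hjk | hjk
      · obtain ⟨c, hc⟩ := hne k
        exact ⟨c, D.toSet_anti hjk hc, hk hc⟩
      · obtain ⟨c, hc⟩ := hne j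
        exact ⟨c, hc, hk (D.toSet_anti hjk hc)⟩
    rw [hj, mem_closedBall_iff] at hcj
    rw [hi, mem_closedBall_iff] at hci
    have hlt : γ ≤ η := by
      by_contra! hlt
      refine hne i fun d hd => ?_
      rw [hi, mem_closedBall_iff] at hd
      rw [hj, mem_closedBall_iff, ← sub_add_sub_cancel d c b]
      refine v.map_le_add ((WithTop.coe_le_coe.2 hlt.le).trans ?_) hcj
      rw [← sub_sub_sub_cancel_right d c a]
      exact v.map_le_sub hd hci
    rw [hi, mem_closedBall_iff, ← sub_sub_sub_cancel_left a b c]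
    exact v.map_le_sub hci ((WithTop.coe_le_coe.2 hlt).trans hcj)
  · intro h
    refine ValExt.toSpace_le_of_between hv hμ.map_C hν.map_C fun f => ?_
    obtain ⟨i, a, γ, hi, e⟩ := hμ.exists_eq f
    obtain ⟨j, hj⟩ := h.1 i
    obtain ⟨b, η, hj'⟩ := D.exists_eq_closedBall j
    refine ⟨a, γ, e.le, le_trans ?_ (hν.le f j b η hj')⟩
    rw [map_le_map_iff hν.strictMono]
    exact monomialValue_le_of_closedBall_subset hv (hi ▸ hj' ▸ hj) f

end Order

/-! ### Every extension is monomial or a stable limit. -/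

section Classification

variable {K Γ : Type u} [Field K] [AddCommGroup Γ] [LinearOrder Γ] [IsOrderedAddMonoid Γ]
  {v : AddValuation K (WithTop Γ)} (hv : ∀ γ : Γ, ∃ a : K, v a = (γ : WithTop Γ))

include hv in
-- Equivalence on `K` makes `μ(c)` a function of `v c`; surjectivity of `v` onto `Γ` makes it a
-- homomorphism defined on all of `Γ`.
theorem ValExt.exists_embedding (μ : ValExt v) :
    ∃ ι : Γ →+ μ.Val, StrictMono ι ∧ ∀ c : K, μ.val (RatFunc.C c) = (v c).map ι := by
  have equiv : ∀ c d : K, μ.val (RatFunc.C c) ≤ μ.val (RatFunc.C d) ↔ v c ≤ v d :=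
    fun c d => μ.isEquiv d c
  have hex : ∀ γ : Γ, ∃ x : μ.Val, ∀ c : K, v c = γ → μ.val (RatFunc.C c) = x := by
    intro γ
    obtain ⟨a, ha⟩ := hv γ
    have hne : μ.val (RatFunc.C a) ≠ ⊤ := by
      rw [μ.val.ne_top_iff, Ne, map_eq_zero, ← v.top_iff, ha]
      exact WithTop.coe_ne_top
    obtain ⟨x, hx⟩ := WithTop.ne_top_iff_exists.1 hne
    refine ⟨x, fun c hc => ?_⟩
    rw [hx]
    exact le_antisymm ((equiv _ _).2 (hc.trans ha.symm).le) ((equiv _ _).2 (hc.trans ha.symm).ge)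
  choose ι₀ h₀ using hex
  let ι : Γ →+ μ.Val := AddMonoidHom.mk' ι₀ fun x y => by
    obtain ⟨a, ha⟩ := hv x
    obtain ⟨b, hb⟩ := hv y
    have h := h₀ (x + y) (a * b) (by rw [v.map_mul, ha, hb, WithTop.coe_add])
    rw [map_mul, μ.val.map_mul, h₀ x a ha, h₀ y b hb] at h
    exact_mod_cast h.symm
  refine ⟨ι, strictMono_of_le_iff_le fun x y => ?_, fun c => ?_⟩
  · obtain ⟨a, ha⟩ := hv x
    obtain ⟨b, hb⟩ := hv y
    have h := equiv a b
    rw [h₀ x a ha, h₀ y b hb, ha, hb, WithTop.coe_le_coe, WithTop.coe_le_coe] at h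
    exact h.symm
  · by_cases hc : c = 0
    · rw [hc, map_zero, μ.val.map_zero, v.map_zero, WithTop.map_top]
    · obtain ⟨γ, hγ⟩ := WithTop.ne_top_iff_exists.1 (v.ne_top_iff.2 hc)
      rw [← hγ, h₀ γ c hγ.symm, WithTop.map_coe]
      rfl

theorem ValExt.isMonomialAt_of_map_X_sub_C [IsAlgClosed K] {μ : ValExt v} {ι : Γ →+ μ.Val}
    (hι : StrictMono ι) (hC : ∀ c : K, μ.val (RatFunc.C c) = (v c).map ι) {a : K} {ξ : μ.Val}
    (h : ∀ d, μ.val (algebraMap K[X] (RatFunc K) (X - C d)) =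
      min ((v (d - a)).map ι) (ξ : WithTop μ.Val)) :
    IsMonomialAt μ a (QuasiCut.ofElement ι hι ξ) ι ξ := by
  refine ⟨hι, hC, QuasiCut.realizes_ofElement ι hι ξ, fun f => ?_⟩
  induction f using polynomial_induction_linear with
  | hC c => rw [RatFunc.algebraMap_C, hC, monomialValue_C, extendValues_apply]
  | hX d => rw [h, monomialValue_X_sub_C, extendValues_apply]
  | hmul f g hf hg => rw [map_mul, μ.val.map_mul, monomialValue_mul, hf, hg]

/-- The nest of the closed balls `{c | γ ≤ g c}`, where `g` is thought of as the function
`c ↦ μ (x - c)` and `γ` runs through the values of `g`. -/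
def Nest.ofValues (v : AddValuation K (WithTop Γ)) (g : K → Γ)
    (hball : ∀ a c, g a ≤ g c ↔ (g a : WithTop Γ) ≤ v (c - a)) (hstep : ∀ a, ∃ d, g a < g d) :
    Nest v where
  Index := Set.range g
  toSet γ := {c | γ.1 ≤ g c}
  exists_eq_closedBall := by
    rintro ⟨_, a, rfl⟩
    exact ⟨a, g a, Set.ext fun c => hball a c⟩
  lt_iff_ssubset := by
    rintro ⟨_, a, rfl⟩ ⟨_, b, rfl⟩
    constructor
    · intro h
      exact ⟨fun c hc => le_trans (le_of_lt h) hc, fun hsub => not_lt.2 (hsub (le_refl (g a))) h⟩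
    · intro h
      refine lt_of_not_ge fun hle => h.2 fun c hc => le_trans hle hc
  iInter_eq_empty := by
    refine Set.eq_empty_of_forall_notMem fun c hc => ?_
    obtain ⟨d, hd⟩ := hstep c
    exact not_lt.2 (Set.mem_iInter.1 hc ⟨g d, d, rfl⟩) hd

include hv in
theorem ValExt.isStableLimitAt_ofValues [IsAlgClosed K] {μ : ValExt v} {ι : Γ →+ μ.Val}
    (hι : StrictMono ι) (hC : ∀ c : K, μ.val (RatFunc.C c) = (v c).map ι) {g : K → Γ}
    (hball : ∀ a c, g a ≤ g c ↔ (g a : WithTop Γ) ≤ v (c - a)) (hstep : ∀ a, ∃ d, g a < g d)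
    (h : ∀ d, μ.val (algebraMap K[X] (RatFunc K) (X - C d)) = ι (g d)) :
    IsStableLimitAt μ (Nest.ofValues v g hball hstep) ι := by
  have stable : ∀ f : K[X], ∃ a, ∀ b, g a ≤ g b →
      μ.val (algebraMap K[X] (RatFunc K) f) = (monomialValue v b (g b) f).map ι := by
    intro f
    induction f using polynomial_induction_linear with
    | hC c => exact ⟨0, fun b _ => by rw [RatFunc.algebraMap_C, hC, monomialValue_C]⟩
    | hX d =>
      -- Beyond such an `a`, `μ(x - b) > μ(x - d)`, so `d - b = (x - b) - (x - d)` has value exactly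
      -- `g d`, which is less than `g b`.
      obtain ⟨a, ha⟩ := hstep d
      refine ⟨a, fun b hb => ?_⟩
      have hdb := ha.trans_le hb
      have h₁ := (hball d b).1 hdb.le
      have h₂ := mt (hball b d).2 (not_le.2 hdb)
      rw [h, monomialValue_X_sub_C, min_eq_left (not_le.1 h₂).le, ← WithTop.map_coe]
      congr 1
      refine le_antisymm (v.map_sub_swap b d ▸ h₁) ?_
      have hμ : (RatFunc.C (d - b) : RatFunc K) = algebraMap K[X] (RatFunc K) (X - C b) -
          algebraMap K[X] (RatFunc K) (X - C d) := by
        rw [← map_sub, sub_sub_sub_cancel_left, ← C_sub, RatFunc.algebraMap_C]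
      have hlt : μ.val (algebraMap K[X] (RatFunc K) (X - C d)) <
          μ.val (algebraMap K[X] (RatFunc K) (X - C b)) := by
        rw [h, h]
        exact WithTop.coe_lt_coe.2 (hι hdb)
      have := μ.val.map_sub_eq_of_lt_right hlt
      rw [← hμ, hC, h, ← WithTop.map_coe] at this
      exact (map_le_map_iff hι _ _).1 this.le
    | hmul f₁ f₂ h₁ h₂ =>
      obtain ⟨a₁, h₁⟩ := h₁
      obtain ⟨a₂, h₂⟩ := h₂
      rcases le_total (g a₁) (g a₂) with hle | hle
      · exact ⟨a₂, fun b hb => by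
          rw [map_mul, μ.val.map_mul, monomialValue_mul, WithTop.map_add, h₁ b (hle.trans hb),
            h₂ b hb]⟩
      · exact ⟨a₁, fun b hb => by
          rw [map_mul, μ.val.map_mul, monomialValue_mul, WithTop.map_add, h₁ b hb,
            h₂ b (hle.trans hb)]⟩
  have ball_eq : ∀ a, {c | g a ≤ g c} = closedBall v a (g a) := fun a => Set.ext fun c => hball a c
  refine ⟨hι, hC, fun f => ?_, ?_⟩
  · obtain ⟨a, ha⟩ := stable f
    exact ⟨⟨g a, a, rfl⟩, a, g a, ball_eq a, ha a le_rfl⟩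
  · rintro f ⟨_, d, rfl⟩ b γ hb
    obtain ⟨a, ha⟩ := stable f
    obtain ⟨e, hae, hde⟩ : ∃ e, g a ≤ g e ∧ g d ≤ g e := by
      rcases le_total (g a) (g d) with hle | hle
      · exact ⟨d, hle, le_rfl⟩
      · exact ⟨a, le_rfl, hle⟩
    rw [ha e hae, map_le_map_iff hι]
    refine monomialValue_le_of_closedBall_subset hv ?_ f
    rw [← ball_eq e, ← hb]
    exact fun c hc => le_trans hde hc

include hv in
theorem ValExt.isMonomialAt_or_isStableLimitAt [IsAlgClosed K] (μ : ValExt v) :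
    ∃ ι : Γ →+ μ.Val, (∃ (a : K) (δ : QuasiCut Γ) (ξ : μ.Val), IsMonomialAt μ a δ ι ξ) ∨
      ∃ B : Nest v, IsStableLimitAt μ B ι := by
  obtain ⟨ι, hι, hC⟩ := μ.exists_embedding hv
  refine ⟨ι, ?_⟩
  have sub_eq : ∀ a d : K, algebraMap K[X] (RatFunc K) (X - C d) =
      algebraMap K[X] (RatFunc K) (X - C a) - RatFunc.C (d - a) := by
    intro a d
    rw [← RatFunc.algebraMap_C, ← map_sub, C_sub, sub_sub_sub_cancel_right]
  have hne : ∀ a : K, ∃ ξ : μ.Val,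
      μ.val (algebraMap K[X] (RatFunc K) (X - C a)) = ξ := by
    intro a
    obtain ⟨ξ, hξ⟩ := WithTop.ne_top_iff_exists.1
      (μ.val.ne_top_iff.2 (RatFunc.algebraMap_ne_zero (X_sub_C_ne_zero a)))
    exact ⟨ξ, hξ.symm⟩
  choose x hx using hne
  by_cases hA : ∃ a, ∀ d, μ.val (algebraMap K[X] (RatFunc K) (X - C d)) =
      min ((v (d - a)).map ι) (x a : WithTop μ.Val)
  · obtain ⟨a, ha⟩ := hA
    exact Or.inl ⟨a, _, x a, ValExt.isMonomialAt_of_map_X_sub_C hι hC ha⟩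
  · push Not at hA
    have hB : ∀ a, ∃ γ : Γ, x a = ι γ ∧ ∃ d, x a < x d := by
      intro a
      obtain ⟨d, hd⟩ := hA a
      -- If the values of `x - a` and `d - a` differed, `μ(x - d)` would be their minimum, contrary
      -- to the choice of `d`. Their equality puts `x a` in the image of `Γ` and forces `μ(x - d) >
      -- μ(x - a)`.
      have heq : μ.val (algebraMap K[X] (RatFunc K) (X - C a)) = μ.val (RatFunc.C (d - a)) := by
        by_contra hn
        apply hd
        rw [sub_eq a d, sub_eq_add_neg, μ.val.map_add_of_distinct_val (by rwa [μ.val.map_neg]),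
          μ.val.map_neg, hx, hC, min_comm]
      rw [← hx, ← hC, ← heq, min_self] at hd
      have hle : μ.val (algebraMap K[X] (RatFunc K) (X - C a)) ≤
          μ.val (algebraMap K[X] (RatFunc K) (X - C d)) := by
        rw [sub_eq a d]
        exact μ.val.map_le_sub le_rfl heq.le
      have hlt := lt_of_le_of_ne hle hd.symm
      rw [hx, hx, WithTop.coe_lt_coe] at hlt
      rw [hx, hC] at heq
      cases hγ : v (d - a) with
      | top => rw [hγ] at heq; exact absurd heq WithTop.coe_ne_top
      | coe γ =>
        rw [hγ, WithTop.map_coe, WithTop.coe_inj] at heq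
        exact ⟨γ, heq, d, hlt⟩
    choose g hg hstep using hB
    have hx' : ∀ d, μ.val (algebraMap K[X] (RatFunc K) (X - C d)) = ι (g d) := fun d => by
      rw [hx, hg]
    refine Or.inr ⟨_, ValExt.isStableLimitAt_ofValues hv hι hC (g := g) (fun a c => ?_)
      (fun a => ?_) hx'⟩
    · have h₁ := sub_eq a c
      have h₂ : (RatFunc.C (c - a) : RatFunc K) = algebraMap K[X] (RatFunc K) (X - C a) -
          algebraMap K[X] (RatFunc K) (X - C c) := by rw [h₁, sub_sub_cancel]
      rw [← hι.le_iff_le, ← map_le_map_iff hι, WithTop.map_coe, ← hC, ← WithTop.coe_le_coe,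
        ← hx', ← hx']
      constructor
      · intro h
        rw [h₂]
        exact μ.val.map_le_sub le_rfl h
      · intro h
        rw [h₁]
        exact μ.val.map_le_sub le_rfl h
    · obtain ⟨d, hd⟩ := hstep a
      rw [hg, hg, hι.lt_iff_lt] at hd
      exact ⟨d, hd⟩

end Classification

/-! ### Assembling the order isomorphism. -/

section Isomorphism

variable {K Γ : Type u} [Field K] [AddCommGroup Γ] [LinearOrder Γ] [IsOrderedAddMonoid Γ]
  {v : AddValuation K (WithTop Γ)} (hv : ∀ γ : Γ, ∃ a : K, v a = (γ : WithTop Γ))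

/-- The valuation `μ` is attached to the given pointed ball or class of nests. -/
def BallSpace.Represents : BallSpace v → ValExt v → Prop
  | .ofBall B, μ => ∃ (a : K) (δ : QuasiCut Γ) (ι : Γ →+ μ.Val) (ξ : μ.Val),
      B = pointedBall v a δ ∧ IsMonomialAt μ a δ ι ξ
  | .ofNest N, μ => ∃ (B : Nest v) (ι : Γ →+ μ.Val),
      N = Quotient.mk (Nest.setoid v) B ∧ IsStableLimitAt μ B ι

include hv in
theorem BallSpace.exists_represents [IsAlgClosed K] (A : BallSpace v) :
    ∃ μ : ValExt v, A.Represents μ := by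
  cases A with
  | ofBall B =>
    obtain ⟨_, δ, a, rfl⟩ := B
    obtain ⟨p, hp⟩ := exists_isMonomial v a δ
    obtain ⟨μ, -, ι, ξ, h⟩ := ValSpace.isMonomial_iff.1 hp
    exact ⟨μ, a, δ, ι, ξ, rfl, h⟩
  | ofNest N =>
    induction N using Quotient.inductionOn with
    | h B =>
      obtain ⟨p, hp⟩ := B.exists_isStableLimit hv
      obtain ⟨μ, -, ι, h⟩ := hp.exists_at
      exact ⟨μ, B, ι, rfl, h⟩

include hv in
theorem ValExt.exists_represented [IsAlgClosed K] (μ : ValExt v) :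
    ∃ A : BallSpace v, A.Represents μ := by
  obtain ⟨ι, ⟨a, δ, ξ, h⟩ | ⟨B, h⟩⟩ := μ.isMonomialAt_or_isStableLimitAt hv
  · exact ⟨.ofBall (pointedBall v a δ), a, δ, ι, ξ, rfl, h⟩
  · exact ⟨.ofNest (Quotient.mk (Nest.setoid v) B), B, ι, rfl, h⟩

include hv in
theorem BallSpace.Represents.toSpace_le_iff [IsAlgClosed K] {A A' : BallSpace v} {μ ν : ValExt v}
    (h : A.Represents μ) (h' : A'.Represents ν) : μ.toSpace ≤ ν.toSpace ↔ A ≤ A' := by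
  cases A with
  | ofBall B =>
    obtain ⟨a, δ, ι, ξ, rfl, h⟩ := h
    cases A' with
    | ofBall C =>
      obtain ⟨b, ε, κ, η, rfl, h'⟩ := h'
      exact h.toSpace_le_iff hv h'
    | ofNest N =>
      obtain ⟨D, κ, rfl, h'⟩ := h'
      exact h.toSpace_le_iff_exists_subset hv h'
  | ofNest N =>
    obtain ⟨B, ι, rfl, h⟩ := h
    cases A' with
    | ofBall C =>
      obtain ⟨b, ε, κ, η, rfl, h'⟩ := h'
      exact iff_of_false (h.not_toSpace_le hv h') id
    | ofNest N =>
      obtain ⟨D, κ, rfl, h'⟩ := h'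
      exact (h.toSpace_le_iff hv h').trans (Quotient.eq (r := Nest.setoid v)).symm

include hv in
theorem BallSpace.Represents.toSpace_eq [IsAlgClosed K] {A : BallSpace v} {μ ν : ValExt v}
    (h : A.Represents μ) (h' : A.Represents ν) : μ.toSpace = ν.toSpace :=
  ((h.toSpace_le_iff hv h').2 le_rfl).antisymm ((h'.toSpace_le_iff hv h).2 le_rfl)

include hv in
theorem BallSpace.exists_orderIso [IsAlgClosed K] :
    ∃ Φ : BallSpace v ≃o ValSpace v,
      ∀ (A : BallSpace v) (μ : ValExt v), A.Represents μ → Φ A = μ.toSpace := by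
  choose m hm using BallSpace.exists_represents hv
  let φ : BallSpace v ↪o ValSpace v := OrderEmbedding.ofMapLEIff (fun A => (m A).toSpace)
    fun A A' => (hm A).toSpace_le_iff hv (hm A')
  have hφ : ∀ (A : BallSpace v) (μ : ValExt v), A.Represents μ → φ A = μ.toSpace :=
    fun A μ h => (hm A).toSpace_eq hv h
  refine ⟨RelIso.ofSurjective φ fun p => ?_, hφ⟩
  induction p using Quotient.inductionOn with
  | h μ =>
    obtain ⟨A, hA⟩ := μ.exists_represented hv
    exact ⟨A, hφ A μ hA⟩

end Isomorphism

end ValTree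

theorem mainTheorem2 {K Γ : Type u} [Field K] [IsAlgClosed K]
    [AddCommGroup Γ] [LinearOrder Γ] [IsOrderedAddMonoid Γ]
    (v : AddValuation K (WithTop Γ)) (hv : ∀ γ : Γ, ∃ a : K, v a = (γ : WithTop Γ)) :
    ∃ Φ : ValTree.BallSpace v ≃o ValTree.ValSpace v,
      (∀ (a : K) (δ : ValTree.QuasiCut Γ) (p : ValTree.ValSpace v),
        Φ (.ofBall (ValTree.pointedBall v a δ)) = p ↔ p.IsMonomial a δ) ∧
      (∀ (B : ValTree.Nest v) (p : ValTree.ValSpace v),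
        Φ (.ofNest (Quotient.mk (ValTree.Nest.setoid v) B)) = p ↔ p.IsStableLimit B) := by
  obtain ⟨Φ, hΦ⟩ := ValTree.BallSpace.exists_orderIso hv
  have ball : ∀ {a : K} {δ : ValTree.QuasiCut Γ} {p : ValTree.ValSpace v}, p.IsMonomial a δ →
      Φ (.ofBall (ValTree.pointedBall v a δ)) = p := by
    intro a δ p hp
    obtain ⟨μ, rfl, ι, ξ, h⟩ := ValTree.ValSpace.isMonomial_iff.1 hp
    exact hΦ _ μ ⟨a, δ, ι, ξ, rfl, h⟩
  have nest : ∀ {B : ValTree.Nest v} {p : ValTree.ValSpace v}, p.IsStableLimit B →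
      Φ (.ofNest (Quotient.mk (ValTree.Nest.setoid v) B)) = p := by
    intro B p hp
    obtain ⟨μ, rfl, ι, h⟩ := hp.exists_at
    exact hΦ _ μ ⟨B, ι, rfl, h⟩
  refine ⟨Φ, fun a δ p => ⟨?_, ball⟩, fun B p => ⟨?_, nest⟩⟩
  -- Some monomial class exists, and `ball` identifies every such class with the value of `Φ`.
  · rintro rfl
    obtain ⟨q, hq⟩ := ValTree.exists_isMonomial v a δ
    rwa [ball hq]
  · rintro rfl
    obtain ⟨q, hq⟩ := B.exists_isStableLimit hv
    rwa [nest hq]
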